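/- Let $\mathcal H$ be the real vector space of symmetric forms of degree $5$ in $a,b,c$, and let $\mathcal P=\mathcal P^{s+}_{3,5}\subset\mathcal H$ be the cone of those $f\in\mathcal H$ with $f(a,b,c)\ge 0$ for all $a,b,c\ge 0$. With $S_{m,n}=a^mb^n+b^mc^n+c^ma^n$, $T_{m,n}=S_{m,n}+S_{n,m}$ and $U=abc$, put $$s_0=S_{5,0}-US_{1,1},\quad s_1=T_{4,1}-2US_{1,1},\quad s_2=T_{3,2}-2US_{1,1},\quad s_3=US_{2,0}-US_{1,1},\quad s_4=US_{1,1}.$$ These form a base of $\mathcal H$, and $f=\sum_i p_is_i$ is identified with $(p_0,\dots,p_4)\in\mathbb R^5$. Let $\Phi(a:b:c)=(s_0:\dots:s_4)$, let $X$ be the image under $\Phi$ of the set of points of the real projective plane having nonnegative coordinates, and decompose $X$ into $C^b=\{\Phi(t:1:1)\mid t>0,\ t\ne1\}$, $C^0=\{\Phi(0:t:1)\mid 0<t<1\}$, $P_1=\Phi(0:0:1)$, $P_2=\Phi(0:1:1)$, $P_3=\Phi(1:1:1)$, and the remaining part $\mathrm{Int}(X)$. For each of these six strata $D$ let $\mathcal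 F(D)$ be the closure in $\mathcal H$ of the set of all $f\in\mathcal P$ that, regarded as linear functionals $(v_0,\dots,v_4)\mapsto\sum_i p_iv_i$, vanish at some point of $D$. The dimension of a subset of $\mathbb R^5$ means the Krull dimension of the coordinate ring of its Zariski closure. If $\dim\mathcal F(D)=\dim\mathcal P-1$, a generator of the (then principal) ideal of all real polynomials vanishing on the Zariski closure of $\mathcal F(D)$ is called a discriminant $\mathrm{disc}_D$ of $\mathcal P$; it is determined up to a nonzero constant factor. **Theorem.** For $D=P_1,P_2,P_3,C^0,C^b$ we have $\dim\mathcal F(D)=\dim\mathcal P-1$, and discriminants are $$\mathrm{disc}_{P_1}=p_0,\qquad \mathrm{disc}_{P_2}=p_0+p_1+p_2,\qquad \mathrm{disc}_{P_3}=p_4,\qquad \mathrm{disc}_{C^0}=5p_0^2+2p_0p_1+p_1^2-4p_0p_2,$$ $$\mathrm{disc}_{C^b}=\frac{\mathrm{Disc}_5(c_5,c_4,c_3,c_2,c_1,c_0)}{16\,p_4},$$ where $\mathrm{Disc}_5(c_5,\dots,c_0)$ is the discriminant of the quintic $\sum_i c_ix^i=f(x,1,1)$, with $c_5=p_0$, $c_4=2p_1$,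 $c_3=2p_2+p_3$, $c_2=-2(p_0+2p_1+p_2+p_3-p_4)$, $c_1=-p_0-2p_2+p_3+p_4$, $c_0=2(p_0+p_1+p_2)$; it is divisible by $16p_4$ in $\mathbb R[p_0,\dots,p_4]$. These are all the discriminants of $\mathcal P$ up to nonzero constant factors, and $\dim\mathcal F(\mathrm{Int}(X))\ne\dim\mathcal P-1$. Moreover $$\partial\mathcal P=\mathcal F(C^b)\cup\mathcal F(C^0)\cup\mathcal F(P_1)\cup\mathcal F(P_2)\cup\mathcal F(P_3),$$ and the minimal primes of the ideal of all real polynomials vanishing on $\partial\mathcal P$ are exactly the five principal ideals generated by the five polynomials above; that is, the irreducible components of the Zariski closure of $\partial\mathcal P$ are the five hypersurfaces they define. -/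

import Mathlib

open MvPolynomial
open scoped LinearAlgebra.Projectivization

noncomputable section

namespace SymQuintic

/-! ### Symmetric quintic forms in three variables -/

/-- The real symmetric forms of degree 5 in the three variables `a = X 0`, `b = X 1`, `c = X 2`. -/
def symForms : Set (MvPolynomial (Fin 3) ℝ) :=
  {f | f.IsSymmetric ∧ f.IsHomogeneous 5}

/-- The PSD cone: symmetric quintic forms that are nonnegative on the nonnegative orthant. -/
def psdForms : Set (MvPolynomial (Fin 3) ℝ) :=
  {f | f ∈ symForms ∧ ∀ x : Fin 3 → ℝ, (∀ i, 0 ≤ x i) → 0 ≤ eval x f}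

/-- `S m n = a^m b^n + b^m c^n + c^m a^n`. -/
def S (m n : ℕ) : MvPolynomial (Fin 3) ℝ :=
  X 0 ^ m * X 1 ^ n + X 1 ^ m * X 2 ^ n + X 2 ^ m * X 0 ^ n

/-- `T m n = S m n + S n m`. -/
def T (m n : ℕ) : MvPolynomial (Fin 3) ℝ := S m n + S n m

/-- `U = abc`. -/
def U : MvPolynomial (Fin 3) ℝ := X 0 * X 1 * X 2

/-- The base `s_0, …, s_4` of the space of symmetric quintic forms. -/
def s : Fin 5 → MvPolynomial (Fin 3) ℝ :=
  ![S 5 0 - U * S 1 1,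
    T 4 1 - 2 * U * S 1 1,
    T 3 2 - 2 * U * S 1 1,
    U * S 2 0 - U * S 1 1,
    U * S 1 1]

/-- The form `∑ p_i s_i` with coordinates `p = (p_0, …, p_4)`. -/
def form (p : Fin 5 → ℝ) : MvPolynomial (Fin 3) ℝ := ∑ i, C (p i) * s i

/-- The PSD cone in the coordinates `p_0, …, p_4`. -/
def cone : Set (Fin 5 → ℝ) := {p | form p ∈ psdForms}

/-! ### The characteristic variety and its critical decomposition -/

/-- Homogeneous coordinates `(s_0(a), …, s_4(a))` of the point `Φ(a)`. -/
def Phi (a : Fin 3 → ℝ) : Fin 5 → ℝ := fun i => eval a (s i)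

/-- `x = Φ(a)` as points of projective 4-space. -/
def IsPhi (x : ℙ ℝ (Fin 5 → ℝ)) (a : Fin 3 → ℝ) : Prop :=
  x.submodule = Submodule.span ℝ {Phi a}

/-- The characteristic variety `X = Φ(ℙ²₊)`. -/
def charVariety : Set (ℙ ℝ (Fin 5 → ℝ)) :=
  {x | ∃ a : Fin 3 → ℝ, (∀ i, 0 ≤ a i) ∧ a ≠ 0 ∧ IsPhi x a}

/-- `C^b = {Φ(t : 1 : 1) | 0 < t, t ≠ 1}`. -/
def Cb : Set (ℙ ℝ (Fin 5 → ℝ)) := {x | ∃ t : ℝ, 0 < t ∧ t ≠ 1 ∧ IsPhi x ![t, 1, 1]}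

/-- `C^0 = {Φ(0 : t : 1) | 0 < t < 1}`. -/
def C0 : Set (ℙ ℝ (Fin 5 → ℝ)) := {x | ∃ t : ℝ, 0 < t ∧ t < 1 ∧ IsPhi x ![0, t, 1]}

/-- The point `P_1 = Φ(0 : 0 : 1)`. -/
def P1 : Set (ℙ ℝ (Fin 5 → ℝ)) := {x | IsPhi x ![0, 0, 1]}

/-- The point `P_2 = Φ(0 : 1 : 1)`. -/
def P2 : Set (ℙ ℝ (Fin 5 → ℝ)) := {x | IsPhi x ![0, 1, 1]}

/-- The point `P_3 = Φ(1 : 1 : 1)`. -/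
def P3 : Set (ℙ ℝ (Fin 5 → ℝ)) := {x | IsPhi x ![1, 1, 1]}

/-- The two-dimensional stratum `Int(X)`: what is left of `X` after removing its boundary
curves and vertices. -/
def intX : Set (ℙ ℝ (Fin 5 → ℝ)) := charVariety \ (Cb ∪ C0 ∪ P1 ∪ P2 ∪ P3)

/-- The critical decomposition `Δ(X)`. -/
def criticalDecomposition : Set (Set (ℙ ℝ (Fin 5 → ℝ))) := {intX, Cb, C0, P1, P2, P3}

/-! ### Boundary components and discriminants -/

/-- `F(D)`: the closure of the set of PSD forms that vanish at some point of the stratum `D`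
(the supporting hyperplanes of `X` that touch it along `D`). Closure is taken in the
coordinate space `ℝ⁵`. -/
def boundaryPart (D : Set (ℙ ℝ (Fin 5 → ℝ))) : Set (Fin 5 → ℝ) :=
  closure {p | p ∈ cone ∧ ∃ x ∈ D, ∀ v ∈ x.submodule, ∑ i, p i * v i = 0}

/-- Zariski closure in `ℝ⁵`. -/
def zariskiClosure (A : Set (Fin 5 → ℝ)) : Set (Fin 5 → ℝ) :=
  zeroLocus ℝ (vanishingIdeal ℝ A)

/-- The dimension of a (semialgebraic) subset of `ℝ⁵`: the Krull dimension of the coordinate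
ring of its Zariski closure. -/
def sdim (A : Set (Fin 5 → ℝ)) : WithBot ℕ∞ :=
  ringKrullDim (MvPolynomial (Fin 5) ℝ ⧸ vanishingIdeal ℝ A)

/-- `g` is a defining equation of the real algebraic set `V`: it generates the ideal of `V`. -/
def IsDefiningEquation (g : MvPolynomial (Fin 5) ℝ) (V : Set (Fin 5 → ℝ)) : Prop :=
  vanishingIdeal ℝ V = Ideal.span {g}

/-- `g` is a discriminant `disc_D` of the cone: `F(D)` has codimension one in the cone, and `g`
is a defining equation of the Zariski closure of `F(D)`. -/
def IsDisc (D : Set (ℙ ℝ (Fin 5 → ℝ))) (g : MvPolynomial (Fin 5) ℝ) : Prop :=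
  sdim (boundaryPart D) + 1 = sdim cone ∧
    IsDefiningEquation g (zariskiClosure (boundaryPart D))

/-! ### The quintic `f(x, 1, 1)` with indeterminate coordinates `p_0, …, p_4` -/

/-- `f(x,1,1) = c_5 x^5 + c_4 x^4 + c_3 x^3 + c_2 x^2 + c_1 x + c_0` for the generic form
`f = ∑ p_i s_i`, where `p_i = X i`. -/
def quintic : Polynomial (MvPolynomial (Fin 5) ℝ) :=
  Polynomial.C (X 0) * Polynomial.X ^ 5
    + Polynomial.C (2 * X 1) * Polynomial.X ^ 4
    + Polynomial.C (2 * X 2 + X 3) * Polynomial.X ^ 3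
    + Polynomial.C (-2 * (X 0 + 2 * X 1 + X 2 + X 3 - X 4)) * Polynomial.X ^ 2
    + Polynomial.C (-X 0 - 2 * X 2 + X 3 + X 4) * Polynomial.X
    + Polynomial.C (2 * (X 0 + X 1 + X 2))

end SymQuintic

end

noncomputable section

namespace SymQuintic

/-! A form lies on the frontier of the cone exactly when it is in the cone and has a zero in the
orthant off the origin. Suppose such a zero has distinct positive coordinates. Near it, with σ₁
fixed, σ₂ and σ₃ vary freely, and a symmetric quintic is affine in σ₃ because σ₃² has degree 6.
Nonnegativity then kills the whole coefficient of σ₃ (`interior_zero`). So `Int(X)` contributes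
codimension at least two, and what is left of the form depends, up to scale, only on σ₂/σ₁², so it
also vanishes at some (t,1,1). Hence the other five strata cover the frontier (`frontier_cone`).

For each of these five, F(D) lies on a hypersurface g = 0: either a linear condition, or the
discriminant expressing that a zero of a nonnegative one-variable polynomial is double. It is the
whole hypersurface up to Zariski closure: g is irreducible, and over a nonempty open set the lines
in one coordinate direction meet F(D), so elimination shows that g divides every polynomial
vanishing on F(D) (`vanishingIdeal_eq_span_of_graph`).

Irreducibility comes from `irreducible_of_line`: if the zeros of g contain a parametrised, hence
irreducible, set meeting some line in at least deg g points, then the factor of g vanishing on that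
set already has full degree. For Cᵇ the parametrisation is by forms with a double root t of
f(x,1,1). The discriminant has degree at most 8 and contains the factor p₄, since x = 1 is always a
double root when p₄ = 0. Seven points on a line therefore suffice. -/

/-! ### Vanishing ideals, dimension and irreducibility of hypersurfaces -/

lemma vanishingIdeal_zariskiClosure (A : Set (Fin 5 → ℝ)) :
    vanishingIdeal ℝ (zariskiClosure A) = vanishingIdeal ℝ A :=
  le_antisymm (vanishingIdeal_anti_mono (zeroLocus_vanishingIdeal_le A))
    (le_vanishingIdeal_zeroLocus _)

/-- A polynomial vanishing on a nonempty open set is zero. -/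
lemma eq_zero_of_eqOn_isOpen {n : ℕ} {W : Set (Fin n → ℝ)} (hW : IsOpen W) (hne : W.Nonempty)
    {h : MvPolynomial (Fin n) ℝ} (hh : ∀ x ∈ W, eval x h = 0) : h = 0 := by
  obtain ⟨x, hx⟩ := hne
  obtain ⟨ε, hε, hb⟩ := Metric.isOpen_iff.1 hW x hx
  refine MvPolynomial.funext_set (fun i => Metric.ball (x i) ε)
    (fun i => ?_) fun y hy => ?_
  · rw [Real.ball_eq_Ioo]
    exact Set.Ioo_infinite (by linarith)
  · rw [map_zero]
    refine hh y (hb ?_)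
    rw [Metric.mem_ball, dist_pi_lt_iff hε]
    exact fun i => hy i trivial

lemma vanishingIdeal_eq_bot {n : ℕ} {A : Set (Fin n → ℝ)} (hne : (interior A).Nonempty) :
    vanishingIdeal ℝ A = ⊥ := by
  refine (Submodule.eq_bot_iff _).2 fun h hh => ?_
  refine eq_zero_of_eqOn_isOpen isOpen_interior hne fun x hx => ?_
  exact hh x (interior_subset hx)

/-- The ideal of the origin. -/
lemma height_ker_eval_zero (n : ℕ) :
    (RingHom.ker (eval (0 : Fin n → ℝ))).height = n := by
  induction n with
  | zero =>
    have : RingHom.ker (eval (0 : Fin 0 → ℝ)) = ⊥ := by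
      refine (Submodule.eq_bot_iff _).2 fun h hh => ?_
      refine MvPolynomial.funext fun x => ?_
      rw [map_zero, Subsingleton.elim x 0]
      exact hh
    rw [this]
    simp
  | succ n ih =>
    let p := RingHom.ker (eval (0 : Fin n → ℝ))
    let e := (finSuccEquiv ℝ n).toRingEquiv
    let φ : Polynomial (MvPolynomial (Fin n) ℝ) →+* ℝ :=
      Polynomial.eval₂RingHom (eval (0 : Fin n → ℝ)) 0
    let P := RingHom.ker φ
    have hφ : Function.Surjective φ := fun r => ⟨Polynomial.C (C r), by simp [φ]⟩
    have : P.IsMaximal := RingHom.ker_isMaximal_of_surjective φ hφ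
    have : P.LiesOver p := ⟨by
      ext x
      simp [p, P, φ, Ideal.under, Ideal.mem_comap, RingHom.mem_ker]⟩
    have h1 := Polynomial.height_eq_height_add_one p P
    have h2 : RingHom.ker (eval (0 : Fin (n+1) → ℝ)) = P.comap (e : _ →+* _) := by
      have : eval (0 : Fin (n+1) → ℝ) = φ.comp (e : _ →+* _) := by
        refine MvPolynomial.ringHom_ext (fun r => ?_) fun i => ?_
        · have : (finSuccEquiv ℝ n) (C r) = Polynomial.C (C r) :=
            by simp [finSuccEquiv_apply]
          simp [φ, e, this]
        · refine Fin.cases ?_ (fun j => ?_) i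
          · simp [φ, e, finSuccEquiv_X_zero]
          · simp [φ, e, finSuccEquiv_X_succ]
      rw [this, RingHom.comap_ker]
    rw [h2, show P.comap (e : _ →+* _) = P.comap e from rfl, RingEquiv.height_comap, h1, ih]
    simp

lemma ringKrullDim_mvPolynomial (n : ℕ) : ringKrullDim (MvPolynomial (Fin n) ℝ) = n := by
  rw [MvPolynomial.ringKrullDim_of_isNoetherianRing]
  simp

/-- A hypersurface through the origin has codimension one. -/
lemma ringKrullDim_quotient_span_add_one {n : ℕ} {g : MvPolynomial (Fin n) ℝ} (hg : g ≠ 0)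
    (hg0 : eval 0 g = 0) :
    ringKrullDim (MvPolynomial (Fin n) ℝ ⧸ Ideal.span {g}) + 1 = n := by
  have : (RingHom.ker (eval (0 : Fin n → ℝ))).IsPrime := RingHom.ker_isPrime _
  -- The dimension drops by exactly one because `g` lies in a prime of maximal height, the ideal of
  -- the origin.
  have := Module.ringKrullDim_quotient_add_one_of_mem_nonZeroDivisors
    (mem_nonZeroDivisors_of_ne_zero hg) (p := RingHom.ker (eval (0 : Fin n → ℝ)))
    (by rw [height_ker_eval_zero, ringKrullDim_mvPolynomial]; rfl) hg0
  rw [this, ringKrullDim_mvPolynomial]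

open Polynomial in
/-- An irreducible polynomial that does not divide `h` has, together with `h`, a nonzero
combination that is constant. -/
lemma exists_combination_eq_C {R : Type*} [CommRing R] [IsDomain R] [NormalizedGCDMonoid R]
    {g h : R[X]} (hg : Irreducible g) (hgh : ¬ g ∣ h) :
    ∃ (a b : R[X]) (c : R), c ≠ 0 ∧ a * g + b * h = Polynomial.C c := by
  by_cases hd : g.natDegree = 0
  · refine ⟨1, 0, g.coeff 0, fun h0 => hg.ne_zero ?_, ?_⟩
    · rw [Polynomial.eq_C_of_natDegree_eq_zero hd, h0, map_zero]
    · rw [one_mul, zero_mul, add_zero]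
      exact Polynomial.eq_C_of_natDegree_eq_zero hd
  · let K := FractionRing R
    have hp := hg.isPrimitive hd
    -- Gauss's lemma: `g` stays irreducible over the fraction field and still does not divide `h`,
    -- so the two are coprime there and their resultant, the constant sought, is nonzero.
    have hgK := (hp.irreducible_iff_irreducible_map_fraction_map (K := K)).1 hg
    have hnd : ¬ g.map (algebraMap R K) ∣ h.map (algebraMap R K) := 
      fun hdvd => hgh (hp.dvd_of_fraction_map_dvd_fraction_map hdvd)
    have hcop := (hgK.coprime_iff_not_dvd).2 hnd
    obtain ⟨a, b, -, -, hab⟩ := exists_mul_add_mul_eq_C_resultant g h (m := g.natDegree)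
      (n := h.natDegree) le_rfl le_rfl (Or.inl hd)
    refine ⟨a, b, _, fun h0 => ?_, by rw [← hab]; ring⟩
    have h1 := resultant_map_map g h g.natDegree h.natDegree (algebraMap R K)
    rw [h0, map_zero] at h1
    refine resultant_ne_zero _ _ hcop ?_
    rwa [natDegree_map_eq_of_injective (IsFractionRing.injective R K),
      natDegree_map_eq_of_injective (IsFractionRing.injective R K)]

lemma finSuccEquiv_rename_succ {n : ℕ} (c : MvPolynomial (Fin n) ℝ) :
    finSuccEquiv ℝ n (rename Fin.succ c) = Polynomial.C c := by
  induction c using MvPolynomial.induction_on with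
  | C r => simp [finSuccEquiv_apply]
  | add p q hp hq => simp [hp, hq]
  | mul_X p i hp => rw [map_mul, map_mul, hp, rename_X, finSuccEquiv_X_succ, ← map_mul]

/-- If `g` did not divide some `h` vanishing on `A`, eliminating the first variable would give a
nonzero `c` in the other variables inside the ideal (g, h). It vanishes on `A`, hence on the
projection of `A`, which contains that of the open set `W`; so `c = 0`. -/
lemma vanishingIdeal_eq_span_of_graph_zero {n : ℕ} {g : MvPolynomial (Fin (n + 1)) ℝ}
    (hg : Irreducible g) {A W : Set (Fin (n + 1) → ℝ)} (hA : ∀ x ∈ A, eval x g = 0)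
    (hW : IsOpen W) (hne : W.Nonempty) (hWA : ∀ x ∈ W, ∃ r, Function.update x 0 r ∈ A) :
    vanishingIdeal ℝ A = Ideal.span {g} := by
  classical
  refine le_antisymm (fun h hh => ?_) ?_
  · rw [Ideal.mem_span_singleton]
    by_contra hgh
    let e := finSuccEquiv ℝ n
    let : NormalizedGCDMonoid (MvPolynomial (Fin n) ℝ) := Classical.arbitrary _
    obtain ⟨a, b, c, hc, habc⟩ := exists_combination_eq_C (g := e g) (h := e h)
      ((MulEquiv.irreducible_iff e).2 hg) (by rwa [map_dvd_iff])
    apply hc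
    have h1 : e.symm a * g + e.symm b * h = rename Fin.succ c := by
      apply e.injective
      rw [finSuccEquiv_rename_succ, ← habc]
      simp
    apply rename_injective _ (Fin.succ_injective n)
    rw [map_zero]
    refine eq_zero_of_eqOn_isOpen hW hne fun x hx => ?_
    obtain ⟨r, hr⟩ := hWA x hx
    have h2 : eval (Function.update x 0 r) (rename Fin.succ c) = 0 := by
      have h3 : eval (Function.update x 0 r) h = 0 := hh _ hr
      rw [← h1, map_add, map_mul, map_mul, hA _ hr, h3]
      simp
    rw [eval_rename] at h2 ⊢
    convert! h2 using 3
  · rw [Ideal.span_singleton_le_iff_mem]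
    exact hA

/-- If `A` lies on the irreducible hypersurface `g = 0` and every line parallel to the `i`-th
axis through a point of a nonempty open set meets `A`, then `g` generates the ideal of `A`. -/
lemma vanishingIdeal_eq_span_of_graph {n : ℕ} {g : MvPolynomial (Fin (n + 1)) ℝ}
    (hg : Irreducible g) {A W : Set (Fin (n + 1) → ℝ)} (hA : ∀ x ∈ A, eval x g = 0)
    (i : Fin (n + 1)) (hW : IsOpen W) (hne : W.Nonempty)
    (hWA : ∀ x ∈ W, ∃ r, Function.update x i r ∈ A) :
    vanishingIdeal ℝ A = Ideal.span {g} := by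
  let σ := Equiv.swap 0 i
  have hσ : ∀ x : Fin (n + 1) → ℝ, (x ∘ σ) ∘ σ = x := fun x => by
    ext j
    simp [σ]
  let φ := (renameEquiv ℝ σ)
  have hφ : ∀ (x : Fin (n + 1) → ℝ) h, eval x (φ h) = eval (x ∘ σ) h := fun x h => by
    simp [φ, eval_rename]
  have hc : Continuous fun x : Fin (n + 1) → ℝ => x ∘ σ := by fun_prop
  have key := vanishingIdeal_eq_span_of_graph_zero (g := φ g) (A := {x | x ∘ σ ∈ A})
    (W := {x | x ∘ σ ∈ W}) ((MulEquiv.irreducible_iff φ).2 hg)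
    (fun x hx => by rw [hφ]; exact hA _ hx) (hW.preimage hc)
    (by
      obtain ⟨x, hx⟩ := hne
      exact ⟨x ∘ σ, by simpa [hσ] using hx⟩)
    (fun x hx => by
      obtain ⟨r, hr⟩ := hWA _ hx
      refine ⟨r, ?_⟩
      suffices hu : Function.update x 0 r ∘ σ = Function.update (x ∘ σ) i r by
        change Function.update x 0 r ∘ σ ∈ A
        rwa [hu]
      ext j
      by_cases hj : j = i
      · subst hj
        simp [σ]
      · have : σ j ≠ 0 := fun h0 => hj (by
          have := congrArg σ h0
          simpa [σ] using this)
        simp [Function.update_of_ne hj, Function.update_of_ne this])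
  refine le_antisymm (fun h hh => ?_) ?_
  · have : φ h ∈ vanishingIdeal ℝ {x : Fin (n + 1) → ℝ | x ∘ σ ∈ A} := fun x hx => by
      have := hh _ hx
      rw [aeval_eq_eval] at this ⊢
      rw [hφ]
      exact this
    rw [key, Ideal.mem_span_singleton, map_dvd_iff] at this
    exact Ideal.mem_span_singleton.2 this
  · rw [Ideal.span_singleton_le_iff_mem]
    exact hA

/-- A polynomial of degree at most `N` in a prime ideal `J` is irreducible when the zero set of
`J` contains `N` points of some line on which the polynomial is not identically zero. -/
lemma irreducible_of_line {n N : ℕ} {g : MvPolynomial (Fin n) ℝ} (hN : g.totalDegree ≤ N)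
    (J : Ideal (MvPolynomial (Fin n) ℝ)) [hJ : J.IsPrime] (hgJ : g ∈ J) (u v : Fin n → ℝ)
    (R : Finset ℝ) (hR : N ≤ R.card) (hJR : ∀ h ∈ J, ∀ r ∈ R, eval (u + r • v) h = 0)
    (hne : ∃ r : ℝ, eval (u + r • v) g ≠ 0) : Irreducible g := by
  classical
  obtain ⟨r₀, hr₀⟩ := hne
  have hg0 : g ≠ 0 := by rintro rfl; simp at hr₀
  have hprod := UniqueFactorizationMonoid.factors_prod hg0
  have hmem : (UniqueFactorizationMonoid.factors g).prod ∈ J := by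
    obtain ⟨w, hw⟩ := hprod.symm
    rw [← hw]
    exact J.mul_mem_right _ hgJ
  -- An irreducible factor `e` of `g` lies in `J`. Restricted to the line it is nonzero with `N`
  -- roots, so its degree is at least that of `g`, and the cofactor is constant.
  obtain ⟨e, he, heJ⟩ := (hJ.multiset_prod_mem_iff_exists_mem _).1 hmem
  have hei := UniqueFactorizationMonoid.irreducible_of_factor e he
  obtain ⟨q, rfl⟩ := UniqueFactorizationMonoid.dvd_of_mem_factors he
  let ψ : MvPolynomial (Fin n) ℝ →ₐ[ℝ] Polynomial ℝ :=
    aeval fun i => Polynomial.C (u i) + Polynomial.X * Polynomial.C (v i)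
  have hψ : ∀ h r, (ψ h).eval r = eval (u + r • v) h := fun h r => by
    have : (Polynomial.evalRingHom r).comp (ψ : _ →+* _) = eval (u + r • v) := by
      refine MvPolynomial.ringHom_ext (fun c => by simp [ψ]) fun i => by simp [ψ]; ring
    exact RingHom.congr_fun this h
  have hE0 : ψ e ≠ 0 := fun h0 => hr₀ (by rw [map_mul, ← hψ, h0]; simp)
  have hEdeg : (ψ e).natDegree ≤ e.totalDegree := by
    have := aeval_natDegree_le (m := e.totalDegree) (n := 1) e le_rfl
      (fun i => Polynomial.C (u i) + Polynomial.X * Polynomial.C (v i)) (fun i => by compute_degree)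
    simpa only [mul_one] using this
  have hcard : R.card ≤ (ψ e).natDegree := by
    refine (Finset.card_le_card fun r hr => ?_).trans
      ((ψ e).roots.toFinset_card_le.trans (ψ e).card_roots')
    rw [Multiset.mem_toFinset, Polynomial.mem_roots hE0, Polynomial.IsRoot, hψ]
    exact hJR e heJ r hr
  have hq0 : q ≠ 0 := right_ne_zero_of_mul hg0
  rw [totalDegree_mul_of_isDomain hei.ne_zero hq0] at hN
  have hq : q.totalDegree = 0 := by omega
  rw [totalDegree_eq_zero_iff_eq_C] at hq
  have hu : IsUnit q := by
    rw [hq]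
    refine IsUnit.map C (isUnit_iff_ne_zero.2 fun h0 => hq0 ?_)
    rw [hq, h0, map_zero]
  exact (irreducible_mul_isUnit hu).2 hei

/-- The minimal primes of a finite intersection of pairwise incomparable primes. -/
lemma minimalPrimes_sInf {R : Type*} [CommRing R] {T : Set (Ideal R)} (hfin : T.Finite)
    (hp : ∀ I ∈ T, I.IsPrime) (hinc : ∀ I ∈ T, ∀ J ∈ T, I ≤ J → I = J) :
    (sInf T).minimalPrimes = T := by
  have hle : ∀ P : Ideal R, P.IsPrime → sInf T ≤ P → ∃ I ∈ T, I ≤ P := by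
    intro P hP hTP
    have := (Ideal.IsPrime.inf_le' (s := hfin.toFinset) (f := id) hP).1
      (by rwa [Finset.inf_id_eq_sInf, hfin.coe_toFinset])
    simpa using this
  ext P
  constructor
  · rintro ⟨⟨hP, hTP⟩, hmin⟩
    obtain ⟨I, hI, hIP⟩ := hle P hP hTP
    have := hmin ⟨hp I hI, sInf_le hI⟩ hIP
    rwa [le_antisymm this hIP]
  · intro hP
    refine ⟨⟨hp P hP, sInf_le hP⟩, fun Q ⟨hQ, hTQ⟩ hQP => ?_⟩
    obtain ⟨I, hI, hIQ⟩ := hle Q hQ hTQ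
    rw [← hinc I hI P hP (hIQ.trans hQP)]
    exact hIQ

/-! ### Symmetric quintics as coordinate vectors -/

/-- The value of the form with coordinates `p` at `(a, b, c)`. -/
def val (p : Fin 5 → ℝ) (a b c : ℝ) : ℝ :=
  p 0 * (a ^ 5 + b ^ 5 + c ^ 5 - a * b * c * (a * b + b * c + c * a))
    + p 1 * (a ^ 4 * b + b ^ 4 * c + c ^ 4 * a + a * b ^ 4 + b * c ^ 4 + c * a ^ 4
      - 2 * (a * b * c * (a * b + b * c + c * a)))
    + p 2 * (a ^ 3 * b ^ 2 + b ^ 3 * c ^ 2 + c ^ 3 * a ^ 2 + a ^ 2 * b ^ 3 + b ^ 2 * c ^ 3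
      + c ^ 2 * a ^ 3 - 2 * (a * b * c * (a * b + b * c + c * a)))
    + p 3 * (a * b * c * (a ^ 2 + b ^ 2 + c ^ 2) - a * b * c * (a * b + b * c + c * a))
    + p 4 * (a * b * c * (a * b + b * c + c * a))

lemma sum_mul_Phi (p : Fin 5 → ℝ) (x : Fin 3 → ℝ) :
    ∑ i, p i * Phi x i = val p (x 0) (x 1) (x 2) := by
  simp [Fin.sum_univ_five, Phi, s, S, T, U, val]
  ring

lemma eval_form (p : Fin 5 → ℝ) (x : Fin 3 → ℝ) : eval x (form p) = val p (x 0) (x 1) (x 2) := by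
  rw [← sum_mul_Phi]
  simp [form, Phi]

lemma val_add (p q : Fin 5 → ℝ) (a b c : ℝ) : val (p + q) a b c = val p a b c + val q a b c := by
  simp [val]; ring

lemma val_smul (r : ℝ) (p : Fin 5 → ℝ) (a b c : ℝ) : val (r • p) a b c = r * val p a b c := by
  simp [val]; ring

lemma val_swap₁₂ (p : Fin 5 → ℝ) (a b c : ℝ) : val p b a c = val p a b c := by
  simp only [val]; ring

lemma val_swap₂₃ (p : Fin 5 → ℝ) (a b c : ℝ) : val p a c b = val p a b c := by
  simp only [val]; ring

lemma val_scale (p : Fin 5 → ℝ) (r a b c : ℝ) :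
    val p (r * a) (r * b) (r * c) = r ^ 5 * val p a b c := by
  simp only [val]; ring

lemma form_isSymmetric (p : Fin 5 → ℝ) : (form p).IsSymmetric := by
  intro σ
  refine MvPolynomial.funext fun x => ?_
  rw [eval_rename, eval_form, eval_form]
  simp only [Function.comp]
  have h : ∀ σ : Equiv.Perm (Fin 3), (σ 0 = 0 ∧ σ 1 = 1 ∧ σ 2 = 2) ∨ (σ 0 = 0 ∧ σ 1 = 2 ∧ σ 2 = 1)
      ∨ (σ 0 = 1 ∧ σ 1 = 0 ∧ σ 2 = 2) ∨ (σ 0 = 1 ∧ σ 1 = 2 ∧ σ 2 = 0)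
      ∨ (σ 0 = 2 ∧ σ 1 = 0 ∧ σ 2 = 1) ∨ (σ 0 = 2 ∧ σ 1 = 1 ∧ σ 2 = 0) := by decide
  rcases h σ with ⟨h0, h1, h2⟩ | ⟨h0, h1, h2⟩ | ⟨h0, h1, h2⟩ | ⟨h0, h1, h2⟩ | ⟨h0, h1, h2⟩ |
    ⟨h0, h1, h2⟩ <;> rw [h0, h1, h2] <;> simp only [val] <;> ring

lemma S_isHomogeneous (m n : ℕ) : (S m n).IsHomogeneous (m + n) := by
  have h : ∀ i j : Fin 3, (X i ^ m * X j ^ n : MvPolynomial (Fin 3) ℝ).IsHomogeneous (m + n) :=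
    fun i j => by
      simpa using ((isHomogeneous_X ℝ i).pow m).mul ((isHomogeneous_X ℝ j).pow n)
  exact ((h 0 1).add (h 1 2)).add (h 2 0)

lemma U_isHomogeneous : U.IsHomogeneous 3 :=
  ((isHomogeneous_X ℝ 0).mul (isHomogeneous_X ℝ 1)).mul (isHomogeneous_X ℝ 2)

lemma T_isHomogeneous (m n : ℕ) : (T m n).IsHomogeneous (m + n) :=
  (S_isHomogeneous m n).add (add_comm n m ▸ S_isHomogeneous n m)

lemma s_isHomogeneous (i : Fin 5) : (s i).IsHomogeneous 5 := by
  have h1 : (U * S 1 1).IsHomogeneous 5 := U_isHomogeneous.mul (S_isHomogeneous 1 1)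
  have h2 : (2 * U * S 1 1).IsHomogeneous 5 := by
    have := (isHomogeneous_C (Fin 3) (2 : ℝ)).mul h1
    rwa [zero_add, map_ofNat, ← mul_assoc] at this
  fin_cases i
  · exact (S_isHomogeneous 5 0).sub h1
  · exact (T_isHomogeneous 4 1).sub h2
  · exact (T_isHomogeneous 3 2).sub h2
  · exact (U_isHomogeneous.mul (S_isHomogeneous 2 0)).sub h1
  · exact h1

lemma form_isHomogeneous (p : Fin 5 → ℝ) : (form p).IsHomogeneous 5 := by
  refine IsHomogeneous.sum _ _ _ fun i _ => ?_
  simpa using (isHomogeneous_C (Fin 3) (p i)).mul (s_isHomogeneous i)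

lemma form_mem_symForms (p : Fin 5 → ℝ) : form p ∈ symForms :=
  ⟨form_isSymmetric p, form_isHomogeneous p⟩

lemma form_injective : Function.Injective form := by
  intro p q h
  have H : ∀ a b c, val p a b c = val q a b c := fun a b c => by
    have := congrArg (eval ![a, b, c]) h
    simpa [eval_form] using this
  have h1 := H 1 0 0
  have h2 := H 1 1 0
  have h3 := H 1 1 1
  have h4 := H 2 1 0
  have h5 := H 2 1 1
  simp only [val] at h1 h2 h3 h4 h5
  ext i
  fin_cases i <;> simp <;> linarith

/-- The exponent `(i, j, k)`. -/
def expo (i j k : ℕ) : Fin 3 →₀ ℕ := Finsupp.equivFunOnFinite.symm ![i, j, k]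

/-- Turns a quintic form into an explicit sum of 21 monomials, which symmetry then merges into five
classes in `exists_form_eq`. -/
lemma eval_eq_sum_expo {f : MvPolynomial (Fin 3) ℝ} (hf : f.IsHomogeneous 5) (x : Fin 3 → ℝ) :
    eval x f = ∑ q ∈ (Finset.range 6 ×ˢ Finset.range 6).filter (fun q => q.1 + q.2 ≤ 5),
      coeff (expo q.1 q.2 (5 - q.1 - q.2)) f * (x 0 ^ q.1 * x 1 ^ q.2 * x 2 ^ (5 - q.1 - q.2)) := by
  classical
  have hinj : Set.InjOn (fun q : ℕ × ℕ => expo q.1 q.2 (5 - q.1 - q.2)) Set.univ := by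
    intro q _ r _ h
    have h0 := DFunLike.congr_fun h 0
    have h1 := DFunLike.congr_fun h 1
    simp [expo] at h0 h1
    exact Prod.ext h0 h1
  have hsum : ∀ i j k, ∏ t, x t ^ (expo i j k) t = x 0 ^ i * x 1 ^ j * x 2 ^ k := fun i j k => by
    simp [expo, Fin.prod_univ_three]
  rw [eval_eq', Finset.sum_subset (s₂ := ((Finset.range 6 ×ˢ Finset.range 6).filter
    (fun q => q.1 + q.2 ≤ 5)).image fun q => expo q.1 q.2 (5 - q.1 - q.2)),
    Finset.sum_image (hinj.mono (Set.subset_univ _))]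
  · exact Finset.sum_congr rfl fun q _ => by rw [hsum]
  · intro m hm
    have hdeg : m 0 + m 1 + m 2 = 5 := by
      have := hf (mem_support_iff.1 hm)
      rw [Finsupp.weight_apply, Finsupp.sum_fintype _ _ (by simp)] at this
      simpa [Fin.sum_univ_three] using this
    rw [Finset.mem_image]
    refine ⟨(m 0, m 1), ?_, ?_⟩
    · simp only [Finset.mem_filter, Finset.mem_product, Finset.mem_range]
      omega
    · ext t
      fin_cases t
      · rfl
      · rfl
      · simp [expo]; omega
  · intro m _ hm
    rw [notMem_support_iff.1 hm, zero_mul]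

lemma coeff_expo_swap₁₂ {f : MvPolynomial (Fin 3) ℝ} (hf : f.IsSymmetric) (i j k : ℕ) :
    coeff (expo i j k) f = coeff (expo j i k) f := by
  have h := coeff_rename_mapDomain _ (Equiv.swap (0 : Fin 3) 1).injective f (expo i j k)
  rw [hf] at h
  rw [← h]
  congr 1
  ext t
  rw [Finsupp.mapDomain_equiv_apply]
  fin_cases t <;> rfl

lemma coeff_expo_swap₂₃ {f : MvPolynomial (Fin 3) ℝ} (hf : f.IsSymmetric) (i j k : ℕ) :
    coeff (expo i j k) f = coeff (expo i k j) f := by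
  have h := coeff_rename_mapDomain _ (Equiv.swap (1 : Fin 3) 2).injective f (expo i j k)
  rw [hf] at h
  rw [← h]
  congr 1
  ext t
  rw [Finsupp.mapDomain_equiv_apply]
  fin_cases t <;> rfl

lemma exists_form_eq {f : MvPolynomial (Fin 3) ℝ} (hf : f ∈ symForms) : ∃ p, form p = f := by
  let c : ℕ → ℕ → ℕ → ℝ := fun i j k => coeff (expo i j k) f
  have h12 : ∀ i j k, c i j k = c j i k := coeff_expo_swap₁₂ hf.1
  have h23 : ∀ i j k, c i j k = c i k j := coeff_expo_swap₂₃ hf.1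
  -- The first four coordinates are coefficients. The coefficient of a²b²c in ∑ pᵢsᵢ is p₄ - p₀ -
  -- 2p₁ - 2p₂ - p₃, whence the last entry.
  refine ⟨![c 5 0 0, c 4 1 0, c 3 2 0, c 3 1 1,
    c 2 2 1 + c 5 0 0 + 2 * c 4 1 0 + 2 * c 3 2 0 + c 3 1 1], ?_⟩
  refine MvPolynomial.funext fun x => ?_
  have h := eval_eq_sum_expo hf.2 x
  rw [Finset.sum_filter, Finset.sum_product] at h
  simp only [Finset.sum_range_succ, Finset.sum_range_zero] at h
  norm_num at h
  simp only [show ∀ i j k, coeff (expo i j k) f = c i j k from fun _ _ _ => rfl] at h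
  rw [h, eval_form]
  rw [h12 0 1 4, h12 0 2 3, h23 0 0 5, h12 0 3 2, h12 0 4 1, h23 1 0 4, h23 1 1 3, h12 1 2 2,
    h23 2 0 3, h12 0 5 0, h12 1 3 1, h12 1 4 0, h23 2 1 2, h12 2 3 0, h23 3 0 2, h23 4 0 1]
  simp [val]
  ring

lemma form_bijOn : Set.BijOn form Set.univ symForms :=
  ⟨fun p _ => form_mem_symForms p, form_injective.injOn, fun f hf => by
    obtain ⟨p, rfl⟩ := exists_form_eq hf
    exact ⟨p, trivial, rfl⟩⟩

/-! ### The cone, its interior and its frontier -/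

lemma mem_cone_iff {p : Fin 5 → ℝ} :
    p ∈ cone ↔ ∀ a b c : ℝ, 0 ≤ a → 0 ≤ b → 0 ≤ c → 0 ≤ val p a b c := by
  constructor
  · intro h a b c ha hb hc
    have := h.2 ![a, b, c] (by intro i; fin_cases i <;> assumption)
    simpa [eval_form] using this
  · intro h
    refine ⟨form_mem_symForms p, fun x hx => ?_⟩
    rw [eval_form]
    exact h _ _ _ (hx 0) (hx 1) (hx 2)

lemma add_mem_cone {p q : Fin 5 → ℝ} (hp : p ∈ cone) (hq : q ∈ cone) : p + q ∈ cone := by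
  rw [mem_cone_iff] at *
  intro a b c ha hb hc
  rw [val_add]
  exact add_nonneg (hp a b c ha hb hc) (hq a b c ha hb hc)

lemma smul_mem_cone {r : ℝ} (hr : 0 ≤ r) {p : Fin 5 → ℝ} (hp : p ∈ cone) : r • p ∈ cone := by
  rw [mem_cone_iff] at *
  intro a b c ha hb hc
  rw [val_smul]
  exact mul_nonneg hr (hp a b c ha hb hc)

/-- By symmetry it is enough to look at ordered arguments. -/
lemma mem_cone_of_ordered {p : Fin 5 → ℝ}
    (h : ∀ x y c : ℝ, 0 ≤ x → 0 ≤ y → 0 ≤ c → 0 ≤ val p (c + y + x) (c + y) c) : p ∈ cone := by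
  have h' : ∀ a b c : ℝ, 0 ≤ c → c ≤ b → b ≤ a → 0 ≤ val p a b c := fun a b c hc hcb hba => by
    have := h (a - b) (b - c) c (by linarith) (by linarith) hc
    simpa using this
  rw [mem_cone_iff]
  intro a b c ha hb hc
  rcases le_total a b with hab | hab <;> rcases le_total b c with hbc | hbc <;>
    rcases le_total a c with hac | hac
  · have := h' c b a ha hab hbc
    rwa [val_swap₁₂, val_swap₂₃, val_swap₁₂] at this
  · have := h' c b a ha hab hbc
    rwa [val_swap₁₂, val_swap₂₃, val_swap₁₂] at this
  · have := h' b c a ha hac hbc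
    rwa [val_swap₂₃, val_swap₁₂] at this
  · have := h' b a c hc hac hab
    rwa [val_swap₁₂] at this
  · have := h' c a b hb hab hac
    rwa [val_swap₁₂, val_swap₂₃] at this
  · have := h' a c b hb hbc hac
    rwa [val_swap₂₃] at this
  · exact h' a b c hc hbc hab
  · exact h' a b c hc hbc hab

/-- In the gaps x = a - b, y = b - c and c of ordered arguments, each base form has only nonnegative
coefficients. -/
lemma single_mem_cone (i : Fin 5) : (Pi.single i 1 : Fin 5 → ℝ) ∈ cone := by
  refine mem_cone_of_ordered fun x y c hx hy hc => ?_
  fin_cases i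
  · have h : val (Pi.single 0 1) (c + y + x) (c + y) c =
      x ^ 5 + 5 * x ^ 4 * y + 5 * x ^ 4 * c + 10 * x ^ 3 * y ^ 2 + 20 * x ^ 3 * y * c
      + 10 * x ^ 3 * c ^ 2 + 10 * x ^ 2 * y ^ 3 + 29 * x ^ 2 * y ^ 2 * c
      + 27 * x ^ 2 * y * c ^ 2 + 8 * x ^ 2 * c ^ 3 + 5 * x * y ^ 4 + 18 * x * y ^ 3 * c
      + 21 * x * y ^ 2 * c ^ 2 + 8 * x * y * c ^ 3 + 2 * y ^ 5 + 9 * y ^ 4 * c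
      + 14 * y ^ 3 * c ^ 2 + 8 * y ^ 2 * c ^ 3 := by
      simp [val]; ring
    change 0 ≤ val (Pi.single 0 1) (c + y + x) (c + y) c
    rw [h]; positivity
  · have h : val (Pi.single 1 1) (c + y + x) (c + y) c =
      x ^ 4 * y + 2 * x ^ 4 * c + 4 * x ^ 3 * y ^ 2 + 12 * x ^ 3 * y * c + 8 * x ^ 3 * c ^ 2
      + 6 * x ^ 2 * y ^ 3 + 22 * x ^ 2 * y ^ 2 * c + 24 * x ^ 2 * y * c ^ 2
      + 8 * x ^ 2 * c ^ 3 + 5 * x * y ^ 4 + 20 * x * y ^ 3 * c + 24 * x * y ^ 2 * c ^ 2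
      + 8 * x * y * c ^ 3 + 2 * y ^ 5 + 10 * y ^ 4 * c + 16 * y ^ 3 * c ^ 2
      + 8 * y ^ 2 * c ^ 3 := by
      simp [val]; ring
    change 0 ≤ val (Pi.single 1 1) (c + y + x) (c + y) c
    rw [h]; positivity
  · have h : val (Pi.single 2 1) (c + y + x) (c + y) c =
      x ^ 3 * y ^ 2 + 2 * x ^ 3 * y * c + 2 * x ^ 3 * c ^ 2 + 4 * x ^ 2 * y ^ 3
      + 10 * x ^ 2 * y ^ 2 * c + 9 * x ^ 2 * y * c ^ 2 + 4 * x ^ 2 * c ^ 3 + 5 * x * y ^ 4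
      + 16 * x * y ^ 3 * c + 15 * x * y ^ 2 * c ^ 2 + 4 * x * y * c ^ 3 + 2 * y ^ 5
      + 8 * y ^ 4 * c + 10 * y ^ 3 * c ^ 2 + 4 * y ^ 2 * c ^ 3 := by
      simp [val]; ring
    change 0 ≤ val (Pi.single 2 1) (c + y + x) (c + y) c
    rw [h]; positivity
  · have h : val (Pi.single 3 1) (c + y + x) (c + y) c =
      x ^ 3 * y * c + x ^ 3 * c ^ 2 + 2 * x ^ 2 * y ^ 2 * c + 3 * x ^ 2 * y * c ^ 2
      + x ^ 2 * c ^ 3 + 2 * x * y ^ 3 * c + 3 * x * y ^ 2 * c ^ 2 + x * y * c ^ 3 + y ^ 4 * c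
      + 2 * y ^ 3 * c ^ 2 + y ^ 2 * c ^ 3 := by
      simp [val]; ring
    change 0 ≤ val (Pi.single 3 1) (c + y + x) (c + y) c
    rw [h]; positivity
  · have h : val (Pi.single 4 1) (c + y + x) (c + y) c =
      x ^ 2 * y ^ 2 * c + 3 * x ^ 2 * y * c ^ 2 + 2 * x ^ 2 * c ^ 3 + 2 * x * y ^ 3 * c
      + 9 * x * y ^ 2 * c ^ 2 + 12 * x * y * c ^ 3 + 5 * x * c ^ 4 + y ^ 4 * c
      + 6 * y ^ 3 * c ^ 2 + 12 * y ^ 2 * c ^ 3 + 10 * y * c ^ 4 + 3 * c ^ 5 := by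
      simp [val]; ring
    change 0 ≤ val (Pi.single 4 1) (c + y + x) (c + y) c
    rw [h]; positivity

/-- A form vanishing at (0,1,1) has p₀ + p₁ + p₂ = 0, so nonnegative combinations of the base do not
supply enough of them. This form and the next one, together with s₃ and s₄, span that hyperplane
inside the cone. -/
lemma s0_sub_s2_mem_cone : ![1, 0, -1, 0, 0] ∈ cone := by
  refine mem_cone_of_ordered fun x y c hx hy hc => ?_
  have h : val ![1, 0, -1, 0, 0] (c + y + x) (c + y) c =
      x ^ 5 + 5 * x ^ 4 * y + 5 * x ^ 4 * c + 9 * x ^ 3 * y ^ 2 + 18 * x ^ 3 * y * c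
      + 8 * x ^ 3 * c ^ 2 + 6 * x ^ 2 * y ^ 3 + 19 * x ^ 2 * y ^ 2 * c
      + 18 * x ^ 2 * y * c ^ 2 + 4 * x ^ 2 * c ^ 3 + 2 * x * y ^ 3 * c
      + 6 * x * y ^ 2 * c ^ 2 + 4 * x * y * c ^ 3 + y ^ 4 * c + 4 * y ^ 3 * c ^ 2
      + 4 * y ^ 2 * c ^ 3 := by
    simp [val]; ring
  rw [h]; positivity

lemma s1_sub_s2_mem_cone : ![0, 1, -1, 0, 0] ∈ cone := by
  refine mem_cone_of_ordered fun x y c hx hy hc => ?_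
  have h : val ![0, 1, -1, 0, 0] (c + y + x) (c + y) c =
      x ^ 4 * y + 2 * x ^ 4 * c + 3 * x ^ 3 * y ^ 2 + 10 * x ^ 3 * y * c + 6 * x ^ 3 * c ^ 2
      + 2 * x ^ 2 * y ^ 3 + 12 * x ^ 2 * y ^ 2 * c + 15 * x ^ 2 * y * c ^ 2
      + 4 * x ^ 2 * c ^ 3 + 4 * x * y ^ 3 * c + 9 * x * y ^ 2 * c ^ 2 + 4 * x * y * c ^ 3
      + 2 * y ^ 4 * c + 6 * y ^ 3 * c ^ 2 + 4 * y ^ 2 * c ^ 3 := by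
    simp [val]; ring
  rw [h]; positivity

lemma mem_cone_of_nonneg {p : Fin 5 → ℝ} (hp : ∀ i, 0 ≤ p i) : p ∈ cone := by
  have h : p = p 0 • Pi.single 0 1 + p 1 • Pi.single 1 1 + p 2 • Pi.single 2 1
      + p 3 • Pi.single 3 1 + p 4 • Pi.single 4 1 := by
    ext i
    fin_cases i <;> simp
  rw [h]
  exact add_mem_cone (add_mem_cone (add_mem_cone (add_mem_cone
    (smul_mem_cone (hp 0) (single_mem_cone 0)) (smul_mem_cone (hp 1) (single_mem_cone 1)))
    (smul_mem_cone (hp 2) (single_mem_cone 2))) (smul_mem_cone (hp 3) (single_mem_cone 3)))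
    (smul_mem_cone (hp 4) (single_mem_cone 4))

lemma continuous_val : Continuous fun q : (Fin 5 → ℝ) × (Fin 3 → ℝ) =>
    val q.1 (q.2 0) (q.2 1) (q.2 2) := by
  unfold val
  fun_prop

lemma continuous_val_left (a b c : ℝ) : Continuous fun p : Fin 5 → ℝ => val p a b c := by
  unfold val
  fun_prop

lemma isClosed_cone : IsClosed cone := by
  have : cone = ⋂ (a : ℝ) (b : ℝ) (c : ℝ) (_ : 0 ≤ a) (_ : 0 ≤ b) (_ : 0 ≤ c),
      {p | 0 ≤ val p a b c} := by
    ext p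
    simp [mem_cone_iff]
  rw [this]
  refine isClosed_iInter fun a => isClosed_iInter fun b => isClosed_iInter fun c =>
    isClosed_iInter fun _ => isClosed_iInter fun _ => isClosed_iInter fun _ => ?_
  exact isClosed_le continuous_const (continuous_val_left a b c)

/-- The sum of fifth powers, the form with coordinates `(1, 0, 0, 0, 1)`. -/
lemma pow_five_sum_pos {a b c : ℝ} (ha : 0 ≤ a) (hb : 0 ≤ b) (hc : 0 ≤ c) (habc : 0 < a + b + c) :
    0 < a ^ 5 + b ^ 5 + c ^ 5 := by
  rcases ha.lt_or_eq with h | h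
  · positivity
  · rcases hb.lt_or_eq with h' | h'
    · positivity
    · have : 0 < c := by linarith
      positivity

/-- An interior form remains in the cone after subtracting a small multiple of a⁵ + b⁵ + c⁵, so it
is strictly positive. Conversely, positivity on the compact simplex persists under small changes of
`p`, and homogeneity carries it to the orthant. -/
lemma mem_interior_cone_iff {p : Fin 5 → ℝ} :
    p ∈ interior cone ↔
      ∀ a b c : ℝ, 0 ≤ a → 0 ≤ b → 0 ≤ c → 0 < a + b + c → 0 < val p a b c := by
  constructor
  · intro h a b c ha hb hc habc
    have hcont : Continuous fun r : ℝ => p - r • ![1, 0, 0, 0, 1] := by fun_prop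
    have h0 : (0 : ℝ) ∈ (fun r : ℝ => p - r • ![1, 0, 0, 0, 1]) ⁻¹' interior cone := by
      rw [Set.mem_preimage, zero_smul, sub_zero]
      exact h
    obtain ⟨ε, hε, hb'⟩ := Metric.isOpen_iff.1 (isOpen_interior.preimage hcont) 0 h0
    have hm := interior_subset (hb' (by
      rw [Metric.mem_ball, dist_zero_right, Real.norm_eq_abs, abs_of_pos (half_pos hε)]
      linarith : ε / 2 ∈ Metric.ball (0 : ℝ) ε))
    have h1 := mem_cone_iff.1 hm a b c ha hb hc
    have h2 : val p a b c = val (p - (ε / 2) • ![1, 0, 0, 0, 1]) a b c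
        + ε / 2 * (a ^ 5 + b ^ 5 + c ^ 5) := by
      simp [val]
      ring
    have h3 := pow_five_sum_pos ha hb hc habc
    rw [h2]
    positivity
  · intro h
    rw [mem_interior_iff_mem_nhds]
    have key : ∀ᶠ q in nhds p, ∀ x ∈ stdSimplex ℝ (Fin 3), 0 < val q (x 0) (x 1) (x 2) := by
      refine (isCompact_stdSimplex ℝ (Fin 3)).eventually_forall_of_forall_eventually fun x hx => ?_
      refine (isOpen_lt continuous_const continuous_val).mem_nhds ?_
      refine h _ _ _ (hx.1 0) (hx.1 1) (hx.1 2) ?_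
      have := hx.2
      rw [Fin.sum_univ_three] at this
      linarith
    filter_upwards [key] with q hq
    rw [mem_cone_iff]
    intro a b c ha hb hc
    rcases (add_nonneg (add_nonneg ha hb) hc).lt_or_eq with hpos | h0
    · have := hq ![(a + b + c)⁻¹ * a, (a + b + c)⁻¹ * b, (a + b + c)⁻¹ * c]
        ⟨by intro i; fin_cases i <;> simp <;> positivity, by
          simp [Fin.sum_univ_three]
          field_simp⟩
      simp only [Matrix.cons_val_zero, Matrix.cons_val_one, Matrix.cons_val] at this
      rw [val_scale] at this
      exact (pos_of_mul_pos_right this (by positivity)).le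
    · have ha0 : a = 0 := by linarith
      have hb0 : b = 0 := by linarith
      have hc0 : c = 0 := by linarith
      simp [ha0, hb0, hc0, val]

lemma mem_frontier_cone_iff {p : Fin 5 → ℝ} :
    p ∈ frontier cone ↔
      p ∈ cone ∧ ∃ a b c : ℝ, 0 ≤ a ∧ 0 ≤ b ∧ 0 ≤ c ∧ 0 < a + b + c ∧ val p a b c = 0 := by
  rw [frontier, isClosed_cone.closure_eq, Set.mem_sdiff, mem_interior_cone_iff]
  refine and_congr_right fun hp => ⟨fun h => ?_, ?_⟩
  · push Not at h
    obtain ⟨a, b, c, ha, hb, hc, habc, hle⟩ := h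
    exact ⟨a, b, c, ha, hb, hc, habc, le_antisymm hle (mem_cone_iff.1 hp a b c ha hb hc)⟩
  · rintro ⟨a, b, c, ha, hb, hc, habc, h0⟩ h
    exact (h a b c ha hb hc habc).ne' h0

lemma interior_cone_nonempty : (interior cone).Nonempty := by
  refine ⟨![1, 0, 0, 0, 1], mem_interior_cone_iff.2 fun a b c ha hb hc habc => ?_⟩
  have h3 := pow_five_sum_pos ha hb hc habc
  simp [val]
  linarith

lemma sdim_cone : sdim cone = 5 := by
  rw [sdim, vanishingIdeal_eq_bot interior_cone_nonempty,
    ringKrullDim_eq_of_ringEquiv (RingEquiv.quotientBot _), ringKrullDim_mvPolynomial]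
  rfl

/-! ### The boundary parts in terms of points of the plane -/

lemma Phi_ne_zero {x : Fin 3 → ℝ} (hx : ∀ i, 0 ≤ x i) (h0 : x ≠ 0) : Phi x ≠ 0 := by
  intro h
  have h1 := sum_mul_Phi ![1, 0, 0, 0, 1] x
  rw [h] at h1
  have h2 : 0 < x 0 + x 1 + x 2 := by
    by_contra hn
    apply h0
    ext i
    fin_cases i <;> simp <;> linarith [hx 0, hx 1, hx 2]
  have h3 := pow_five_sum_pos (hx 0) (hx 1) (hx 2) h2
  simp [val] at h1
  linarith

lemma forall_mem_submodule_iff {x : ℙ ℝ (Fin 5 → ℝ)} {a : Fin 3 → ℝ} (hx : IsPhi x a)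
    (p : Fin 5 → ℝ) :
    (∀ v ∈ x.submodule, ∑ i, p i * v i = 0) ↔ val p (a 0) (a 1) (a 2) = 0 := by
  rw [hx, ← sum_mul_Phi]
  constructor
  · exact fun h => h _ (Submodule.mem_span_singleton_self _)
  · intro h v hv
    obtain ⟨r, rfl⟩ := Submodule.mem_span_singleton.1 hv
    have : ∑ i, p i * (r • Phi a) i = r * ∑ i, p i * Phi a i := by
      rw [Finset.mul_sum]
      exact Finset.sum_congr rfl fun i _ => by simp; ring
    rw [this, h, mul_zero]

lemma exists_isPhi {a : Fin 3 → ℝ} (ha : ∀ i, 0 ≤ a i) (h0 : a ≠ 0) : ∃ x, IsPhi x a :=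
  ⟨Projectivization.mk ℝ _ (Phi_ne_zero ha h0), Projectivization.submodule_mk _ _⟩

/-- Replaces a projective stratum by affine representatives `Q`; `hQ` makes Φ nonzero on `Q`, so
every representative does define a projective point. -/
lemma boundaryPart_eq {D : Set (ℙ ℝ (Fin 5 → ℝ))} {Q : Set (Fin 3 → ℝ)}
    (hQ : ∀ a ∈ Q, (∀ i, 0 ≤ a i) ∧ a ≠ 0) (hD : D = {x | ∃ a ∈ Q, IsPhi x a}) :
    boundaryPart D = closure {p | p ∈ cone ∧ ∃ a ∈ Q, val p (a 0) (a 1) (a 2) = 0} := by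
  rw [boundaryPart]
  congr 1
  ext p
  refine and_congr_right fun _ => ⟨?_, ?_⟩
  · rintro ⟨x, hx, h⟩
    rw [hD] at hx
    obtain ⟨a, ha, hxa⟩ := hx
    exact ⟨a, ha, (forall_mem_submodule_iff hxa p).1 h⟩
  · rintro ⟨a, ha, h⟩
    obtain ⟨x, hx⟩ := exists_isPhi (hQ a ha).1 (hQ a ha).2
    exact ⟨x, by rw [hD]; exact ⟨a, ha, hx⟩, (forall_mem_submodule_iff hx p).2 h⟩

lemma vec_nonneg {a b c : ℝ} (ha : 0 ≤ a) (hb : 0 ≤ b) (hc : 0 < c) :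
    (∀ i, 0 ≤ ![a, b, c] i) ∧ ![a, b, c] ≠ 0 :=
  ⟨by intro i; fin_cases i <;> simp [ha, hb, hc.le], fun h => hc.ne' (congrFun h 2)⟩

lemma boundaryPart_Cb : boundaryPart Cb =
    closure {p | p ∈ cone ∧ ∃ t : ℝ, 0 < t ∧ t ≠ 1 ∧ val p t 1 1 = 0} := by
  rw [boundaryPart_eq (Q := {a | ∃ t : ℝ, 0 < t ∧ t ≠ 1 ∧ a = ![t, 1, 1]})]
  · congr! 4 with p
    constructor
    · rintro ⟨_, ⟨t, h1, h2, rfl⟩, h⟩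
      exact ⟨t, h1, h2, h⟩
    · rintro ⟨t, h1, h2, h⟩
      exact ⟨_, ⟨t, h1, h2, rfl⟩, h⟩
  · rintro _ ⟨t, h1, -, rfl⟩
    exact vec_nonneg h1.le zero_le_one one_pos
  · ext x
    constructor
    · rintro ⟨t, h1, h2, h⟩
      exact ⟨_, ⟨t, h1, h2, rfl⟩, h⟩
    · rintro ⟨_, ⟨t, h1, h2, rfl⟩, h⟩
      exact ⟨t, h1, h2, h⟩

lemma boundaryPart_C0 : boundaryPart C0 =
    closure {p | p ∈ cone ∧ ∃ t : ℝ, 0 < t ∧ t < 1 ∧ val p 0 t 1 = 0} := by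
  rw [boundaryPart_eq (Q := {a | ∃ t : ℝ, 0 < t ∧ t < 1 ∧ a = ![0, t, 1]})]
  · congr! 4 with p
    constructor
    · rintro ⟨_, ⟨t, h1, h2, rfl⟩, h⟩
      exact ⟨t, h1, h2, h⟩
    · rintro ⟨t, h1, h2, h⟩
      exact ⟨_, ⟨t, h1, h2, rfl⟩, h⟩
  · rintro _ ⟨t, h1, -, rfl⟩
    exact vec_nonneg le_rfl h1.le one_pos
  · ext x
    constructor
    · rintro ⟨t, h1, h2, h⟩
      exact ⟨_, ⟨t, h1, h2, rfl⟩, h⟩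
    · rintro ⟨_, ⟨t, h1, h2, rfl⟩, h⟩
      exact ⟨t, h1, h2, h⟩

lemma boundaryPart_point {a b c : ℝ} (ha : 0 ≤ a) (hb : 0 ≤ b) (hc : 0 < c) :
    boundaryPart {x | IsPhi x ![a, b, c]} = {p | p ∈ cone ∧ val p a b c = 0} := by
  rw [boundaryPart_eq (Q := {![a, b, c]})]
  · have : {p | p ∈ cone ∧ ∃ x ∈ ({![a, b, c]} : Set (Fin 3 → ℝ)), val p (x 0) (x 1) (x 2) = 0}
        = {p | p ∈ cone ∧ val p a b c = 0} := by
      ext p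
      simp
    rw [this]
    exact (isClosed_cone.inter (isClosed_eq (continuous_val_left a b c)
      continuous_const)).closure_eq
  · rintro _ rfl
    exact vec_nonneg ha hb hc
  · ext x
    simp

lemma boundaryPart_P1 : boundaryPart P1 = {p | p ∈ cone ∧ val p 0 0 1 = 0} :=
  boundaryPart_point le_rfl le_rfl one_pos

lemma boundaryPart_P2 : boundaryPart P2 = {p | p ∈ cone ∧ val p 0 1 1 = 0} :=
  boundaryPart_point le_rfl zero_le_one one_pos

lemma boundaryPart_P3 : boundaryPart P3 = {p | p ∈ cone ∧ val p 1 1 1 = 0} :=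
  boundaryPart_point zero_le_one zero_le_one one_pos

/-! ### Zeros at points with distinct positive coordinates -/

/-- A form in terms of the elementary symmetric polynomials. -/
lemma val_eq_esymm (p : Fin 5 → ℝ) {a b c P q r : ℝ} (hP : a + b + c = P)
    (hq : a * b + b * c + c * a = q) (hr : a * b * c = r) :
    val p a b c = p 0 * P ^ 5 + (p 1 - 5 * p 0) * P ^ 3 * q
      + (5 * p 0 - 3 * p 1 + p 2) * P * q ^ 2
      + r * ((5 * p 0 - p 1 - 2 * p 2 + p 3) * P ^ 2
        + (-6 * p 0 + 3 * p 1 - 3 * p 2 - 3 * p 3 + p 4) * q) := by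
  subst hP hq hr
  simp only [val]
  ring

lemma exists_root_Ioo {f : ℝ → ℝ} (hf : Continuous f) {u v : ℝ} (huv : u < v)
    (h : f u < 0 ∧ 0 < f v ∨ f v < 0 ∧ 0 < f u) : ∃ x ∈ Set.Ioo u v, f x = 0 := by
  rcases h with ⟨h1, h2⟩ | ⟨h1, h2⟩
  · exact intermediate_value_Ioo huv.le hf.continuousOn ⟨h1, h2⟩
  · exact intermediate_value_Ioo' huv.le hf.continuousOn ⟨h1, h2⟩

/-- Near a point with distinct positive coordinates, the last two elementary symmetric
polynomials can be prescribed arbitrarily. -/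
lemma eventually_exists_esymm {x y z : ℝ} (hz : 0 < z) (hzy : z < y) (hyx : y < x) :
    ∀ᶠ w : ℝ × ℝ in nhds (x * y + y * z + z * x, x * y * z), ∃ a b c : ℝ, 0 ≤ a ∧ 0 ≤ b ∧ 0 ≤ c ∧
      a + b + c = x + y + z ∧ a * b + b * c + c * a = w.1 ∧ a * b * c = w.2 := by
  -- The monic cubic with prescribed elementary symmetric functions. At the base point its roots are
  -- x, y, z; its signs at 0, at the two midpoints and at x + 1 alternate and are stable, so three
  -- distinct positive roots survive.
  let g : ℝ × ℝ → ℝ → ℝ := fun w T => T ^ 3 - (x + y + z) * T ^ 2 + w.1 * T - w.2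
  have hg : ∀ T, Continuous fun w => g w T := fun T => by simp only [g]; fun_prop
  have hgT : ∀ w, Continuous (g w) := fun w => by simp only [g]; fun_prop
  have hfac : ∀ T, g (x * y + y * z + z * x, x * y * z) T = (T - x) * (T - y) * (T - z) :=
    fun T => by simp only [g]; ring
  have h0 : ∀ᶠ w in nhds (x * y + y * z + z * x, x * y * z), g w 0 < 0 := by
    refine (hg 0).continuousAt.eventually_lt_const ?_
    change g _ 0 < 0
    rw [hfac]
    have : 0 < x * y * z := by
      have := hz.trans hzy
      have := this.trans hyx
      positivity
    linarith
  have h1 : ∀ᶠ w in nhds (x * y + y * z + z * x, x * y * z), 0 < g w ((y + z) / 2) := by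
    refine (hg _).continuousAt.eventually_const_lt ?_
    change 0 < g _ _
    rw [hfac]
    exact mul_pos (mul_pos_of_neg_of_neg (by linarith) (by linarith)) (by linarith)
  have h2 : ∀ᶠ w in nhds (x * y + y * z + z * x, x * y * z), g w ((x + y) / 2) < 0 := by
    refine (hg _).continuousAt.eventually_lt_const ?_
    change g _ _ < 0
    rw [hfac]
    exact mul_neg_of_neg_of_pos (mul_neg_of_neg_of_pos (by linarith) (by linarith)) (by linarith)
  have h3 : ∀ᶠ w in nhds (x * y + y * z + z * x, x * y * z), 0 < g w (x + 1) := by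
    refine (hg _).continuousAt.eventually_const_lt ?_
    change 0 < g _ _
    rw [hfac]
    exact mul_pos (mul_pos (by linarith) (by linarith)) (by linarith)
  filter_upwards [h0, h1, h2, h3] with w h0 h1 h2 h3
  obtain ⟨c, hc, hgc⟩ := exists_root_Ioo (hgT w) (by linarith) (Or.inl ⟨h0, h1⟩)
  obtain ⟨b, hb, hgb⟩ := exists_root_Ioo (hgT w) (by linarith) (Or.inr ⟨h2, h1⟩)
  obtain ⟨a, ha, hga⟩ := exists_root_Ioo (hgT w) (by linarith) (Or.inl ⟨h2, h3⟩)
  simp only [g] at hgc hgb hga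
  have hcb : c < b := hc.2.trans hb.1
  have hba : b < a := hb.2.trans ha.1
  -- Divided differences of the cubic at its three roots yield Vieta's formulas.
  have e1 : a ^ 2 + a * b + b ^ 2 - (x + y + z) * (a + b) + w.1 = 0 := by
    apply mul_left_cancel₀ (sub_pos.2 hba).ne'
    linear_combination hga - hgb
  have e2 : b ^ 2 + b * c + c ^ 2 - (x + y + z) * (b + c) + w.1 = 0 := by
    apply mul_left_cancel₀ (sub_pos.2 hcb).ne'
    linear_combination hgb - hgc
  have e3 : a + b + c - (x + y + z) = 0 := by
    apply mul_left_cancel₀ (sub_pos.2 (hcb.trans hba)).ne'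
    linear_combination e1 - e2
  have hc0 := hc.1
  refine ⟨a, b, c, by linarith, by linarith, by linarith, by linarith, ?_, ?_⟩
  · linear_combination -e1 + (a + b) * e3
  · linear_combination hga - a * e1 + (a * b) * e3

/-- First-order condition: if `c ≠ 0`, then t(c + et) changes sign at t = 0. -/
lemma eq_zero_of_mul_nonneg {δ c e : ℝ} (hδ : 0 < δ)
    (h : ∀ t : ℝ, |t| < δ → 0 ≤ t * (c + e * t)) : c = 0 := by
  have hlim : Filter.Tendsto (fun t : ℝ => c + e * t) (nhds 0) (nhds c) := by
    have : Continuous fun t : ℝ => c + e * t := by fun_prop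
    simpa using this.tendsto 0
  have habs : ∀ᶠ t : ℝ in nhds 0, |t| < δ := by
    have := Metric.ball_mem_nhds (0 : ℝ) hδ
    filter_upwards [this] with t ht
    simpa using ht
  refine le_antisymm ?_ ?_
  · refine le_of_tendsto (hlim.mono_left (nhdsWithin_le_nhds (s := Set.Iio 0))) ?_
    filter_upwards [nhdsWithin_le_nhds habs, self_mem_nhdsWithin] with t ht (h0 : t < 0)
    by_contra! hn
    exact absurd (h t ht) (not_le.2 (mul_neg_of_neg_of_pos h0 hn))
  · refine ge_of_tendsto (hlim.mono_left (nhdsWithin_le_nhds (s := Set.Ioi 0))) ?_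
    filter_upwards [nhdsWithin_le_nhds habs, self_mem_nhdsWithin] with t ht (h0 : 0 < t)
    exact nonneg_of_mul_nonneg_right (h t ht) h0

/-- A form in the cone with a zero at a point with distinct positive coordinates is a
multiple of `σ₁ (σ₂ - κ σ₁²)²`. -/
lemma interior_zero {p : Fin 5 → ℝ} (hp : p ∈ cone) {x y z : ℝ} (hz : 0 < z) (hzy : z < y)
    (hyx : y < x) (h0 : val p x y z = 0) :
    5 * p 0 - p 1 - 2 * p 2 + p 3 = 0 ∧ -6 * p 0 + 3 * p 1 - 3 * p 2 - 3 * p 3 + p 4 = 0 ∧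
      p 0 * (x + y + z) ^ 4 + (p 1 - 5 * p 0) * (x + y + z) ^ 2 * (x * y + y * z + z * x)
        + (5 * p 0 - 3 * p 1 + p 2) * (x * y + y * z + z * x) ^ 2 = 0 := by
  have hev := eventually_exists_esymm hz hzy hyx
  have hPpos : 0 < x + y + z := by linarith
  rw [val_eq_esymm p rfl rfl rfl] at h0
  set P := x + y + z
  set q := x * y + y * z + z * x
  set r := x * y * z
  set α₁ := p 1 - 5 * p 0
  set α₂ := 5 * p 0 - 3 * p 1 + p 2
  set β₀ := 5 * p 0 - p 1 - 2 * p 2 + p 3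
  set β₁ := -6 * p 0 + 3 * p 1 - 3 * p 2 - 3 * p 3 + p 4
  obtain ⟨δ, hδ, hball⟩ := Metric.eventually_nhds_iff.1 hev
  -- Change of the form when σ₂ moves by `h` and σ₃ by `k`. It is affine in `k`.
  have key : ∀ h k : ℝ, |h| < δ → |k| < δ →
      0 ≤ k * (β₀ * P ^ 2 + β₁ * q)
        + h * ((α₁ * P ^ 3 + 2 * α₂ * P * q + r * β₁) + k * β₁ + α₂ * P * h) := by
    intro h k hh hk
    obtain ⟨a, b, c, ha, hb, hc, e1, e2, e3⟩ := hball (y := (q + h, r + k)) (by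
      rw [Prod.dist_eq, max_lt_iff, Real.dist_eq, Real.dist_eq]
      simpa using ⟨hh, hk⟩)
    have := mem_cone_iff.1 hp a b c ha hb hc
    rw [val_eq_esymm p e1 e2 e3] at this
    linear_combination this + h0
  have hB : β₀ * P ^ 2 + β₁ * q = 0 := by
    refine eq_zero_of_mul_nonneg (e := 0) hδ fun t ht => ?_
    have := key 0 t (by simpa using hδ) ht
    linarith
  -- The first-order condition in `h` holds for every small fixed `k`, not only at `k = 0`;
  -- comparing two values of `k` isolates `β₁`.
  have hA : ∀ k, |k| < δ → (α₁ * P ^ 3 + 2 * α₂ * P * q + r * β₁) + k * β₁ = 0 := by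
    intro k hk
    refine eq_zero_of_mul_nonneg (e := α₂ * P) hδ fun t ht => ?_
    have := key t k ht hk
    rw [hB] at this
    linarith
  have hA0 := hA 0 (by simpa using hδ)
  have hA1 := hA (δ / 2) (by rw [abs_of_pos (half_pos hδ)]; linarith)
  have hβ₁ : β₁ = 0 := by
    apply mul_left_cancel₀ (half_pos hδ).ne'
    linear_combination hA1 - hA0
  have hβ₀ : β₀ = 0 := by
    apply mul_right_cancel₀ (pow_pos hPpos 2).ne'
    linear_combination hB - q * hβ₁
  refine ⟨hβ₀, hβ₁, ?_⟩
  apply mul_left_cancel₀ hPpos.ne'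
  linear_combination h0 - r * hB

/-- By `interior_zero` the form is σ₁ times a quadratic form in σ₁² and σ₂, so its vanishing depends
only on σ₂/σ₁². Every ratio in (0, 1/3) is attained at some (t,1,1) with t > 1. -/
lemma exists_zero_of_interior_zero {p : Fin 5 → ℝ} (hp : p ∈ cone) {x y z : ℝ} (hz : 0 < z)
    (hzy : z < y) (hyx : y < x) (h0 : val p x y z = 0) :
    ∃ t : ℝ, 0 < t ∧ t ≠ 1 ∧ val p t 1 1 = 0 := by
  obtain ⟨hβ₀, hβ₁, hA⟩ := interior_zero hp hz hzy hyx h0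
  have hy : 0 < y := hz.trans hzy
  have hx : 0 < x := hy.trans hyx
  have hq : 0 < x * y + y * z + z * x := by positivity
  have hP : 0 < x + y + z := by positivity
  have hPq : 3 * (x * y + y * z + z * x) < (x + y + z) ^ 2 := by
    nlinarith [sq_pos_of_pos (sub_pos.2 hzy), sq_pos_of_pos (sub_pos.2 hyx), sq_nonneg (x - z)]
  generalize x + y + z = P at *
  generalize x * y + y * z + z * x = q at *
  -- The equation says that (t,1,1) has ratio q/P². Its left side is 3(P² - 3q) > 0 at t = 1, and
  -- -7P² - 4q < 0 at the chosen right endpoint.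
  obtain ⟨t, ht, hroot⟩ : ∃ t ∈ Set.Ioo (1 : ℝ) (2 * P ^ 2 / q), P ^ 2 * (2 * t + 1) - q * (t + 2) ^ 2 = 0 := by
    refine exists_root_Ioo (by fun_prop) ?_ (Or.inr ⟨?_, ?_⟩)
    · rw [lt_div_iff₀ hq]
      linarith
    · have : P ^ 2 * (2 * (2 * P ^ 2 / q) + 1) - q * (2 * P ^ 2 / q + 2) ^ 2
          = -7 * P ^ 2 - 4 * q := by
        field_simp
        ring
      rw [this]
      nlinarith
    · linarith
  have ht1 := ht.1
  refine ⟨t, by linarith, by linarith, ?_⟩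
  rw [val_eq_esymm p rfl rfl rfl, hβ₀, hβ₁]
  have hQ : t * 1 + 1 * 1 + 1 * t = q * (t + 2) ^ 2 / P ^ 2 := by
    field_simp
    linarith
  rw [hQ, show t + 1 + 1 = t + 2 by ring]
  have : p 0 * (t + 2) ^ 5 + (p 1 - 5 * p 0) * (t + 2) ^ 3 * (q * (t + 2) ^ 2 / P ^ 2)
      + (5 * p 0 - 3 * p 1 + p 2) * (t + 2) * (q * (t + 2) ^ 2 / P ^ 2) ^ 2
      = (t + 2) ^ 5 / P ^ 4 * (p 0 * P ^ 4 + (p 1 - 5 * p 0) * P ^ 2 * q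
        + (5 * p 0 - 3 * p 1 + p 2) * q ^ 2) := by
    field_simp
  rw [this, hA]
  ring

/-! ### Sorting zeros into strata; decomposition of the frontier -/

/-- The strata, up to symmetry and scaling. -/
lemma classify_point {Z : ℝ → ℝ → ℝ → Prop} (h12 : ∀ a b c, Z a b c → Z b a c)
    (h23 : ∀ a b c, Z a b c → Z a c b)
    (hscale : ∀ r a b c, 0 < r → Z a b c → Z (r * a) (r * b) (r * c))
    {a b c : ℝ} (ha : 0 ≤ a) (hb : 0 ≤ b) (hc : 0 ≤ c) (habc : 0 < a + b + c) (h : Z a b c) :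
    (∃ t : ℝ, 0 < t ∧ t ≠ 1 ∧ Z t 1 1) ∨ (∃ t : ℝ, 0 < t ∧ t < 1 ∧ Z 0 t 1) ∨
      Z 0 0 1 ∨ Z 0 1 1 ∨ Z 1 1 1 ∨ ∃ x y z, 0 < z ∧ z < y ∧ y < x ∧ Z x y z := by
  have main : ∀ a b c : ℝ, 0 ≤ c → c ≤ b → b ≤ a → 0 < a → Z a b c →
      (∃ t : ℝ, 0 < t ∧ t ≠ 1 ∧ Z t 1 1) ∨ (∃ t : ℝ, 0 < t ∧ t < 1 ∧ Z 0 t 1) ∨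
      Z 0 0 1 ∨ Z 0 1 1 ∨ Z 1 1 1 ∨ ∃ x y z, 0 < z ∧ z < y ∧ y < x ∧ Z x y z := by
    intro a b c hc hcb hba ha h
    have hs := hscale a⁻¹ _ _ _ (inv_pos.2 ha) h
    rw [inv_mul_cancel₀ ha.ne'] at hs
    rcases hc.eq_or_lt with hc0 | hc0
    · subst hc0
      rw [mul_zero] at hs
      rcases hcb.eq_or_lt with hb0 | hb0
      · subst hb0
        rw [mul_zero] at hs
        exact Or.inr (Or.inr (Or.inl (h23 _ _ _ (h12 _ _ _ hs))))
      · have hs2 : Z 0 (a⁻¹ * b) 1 := h12 _ _ _ (h23 _ _ _ (h12 _ _ _ hs))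
        rcases hba.eq_or_lt with hba' | hba'
        · subst hba'
          rw [inv_mul_cancel₀ ha.ne'] at hs2
          exact Or.inr (Or.inr (Or.inr (Or.inl hs2)))
        · refine Or.inr (Or.inl ⟨a⁻¹ * b, by positivity, ?_, hs2⟩)
          rw [inv_mul_lt_iff₀ ha]
          linarith
    · have hb : 0 < b := hc0.trans_le hcb
      rcases hcb.eq_or_lt with hcb' | hcb'
      · subst hcb'
        have hs2 := hscale c⁻¹ _ _ _ (inv_pos.2 hc0) h
        rw [inv_mul_cancel₀ hc0.ne'] at hs2
        rcases hba.eq_or_lt with hba' | hba'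
        · subst hba'
          rw [inv_mul_cancel₀ hc0.ne'] at hs2
          exact Or.inr (Or.inr (Or.inr (Or.inr (Or.inl hs2))))
        · refine Or.inl ⟨c⁻¹ * a, by positivity, ?_, hs2⟩
          rw [ne_eq, inv_mul_eq_iff_eq_mul₀ hc0.ne', mul_one]
          exact hba'.ne'
      · rcases hba.eq_or_lt with hba' | hba'
        · subst hba'
          rw [inv_mul_cancel₀ ha.ne'] at hs
          refine Or.inl ⟨b⁻¹ * c, by positivity, ?_, h12 _ _ _ (h23 _ _ _ hs)⟩
          rw [ne_eq, inv_mul_eq_iff_eq_mul₀ ha.ne', mul_one]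
          exact hcb'.ne
        · exact Or.inr (Or.inr (Or.inr (Or.inr (Or.inr ⟨a, b, c, hc0, hcb', hba', h⟩))))
  rcases le_total a b with hab | hab <;> rcases le_total b c with hbc | hbc <;>
    rcases le_total a c with hac | hac
  · exact main c b a ha hab hbc (by linarith) (h12 _ _ _ (h23 _ _ _ (h12 _ _ _ h)))
  · exact main c b a ha hab hbc (by linarith) (h12 _ _ _ (h23 _ _ _ (h12 _ _ _ h)))
  · exact main b c a ha hac hbc (by linarith) (h23 _ _ _ (h12 _ _ _ h))
  · exact main b a c hc hac hab (by linarith) (h12 _ _ _ h)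
  · exact main c a b hb hab hac (by linarith) (h12 _ _ _ (h23 _ _ _ h))
  · exact main a c b hb hbc hac (by linarith) (h23 _ _ _ h)
  · exact main a b c hc hbc hab (by linarith) h
  · exact main a b c hc hbc hab (by linarith) h

/-- A form on the boundary of the cone has a zero on one of the strata other than `Int(X)`. -/
lemma exists_zero_of_mem_frontier {p : Fin 5 → ℝ} (hp : p ∈ frontier cone) :
    (∃ t : ℝ, 0 < t ∧ t ≠ 1 ∧ val p t 1 1 = 0) ∨ (∃ t : ℝ, 0 < t ∧ t < 1 ∧ val p 0 t 1 = 0) ∨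
      val p 0 0 1 = 0 ∨ val p 0 1 1 = 0 ∨ val p 1 1 1 = 0 := by
  obtain ⟨hp, a, b, c, ha, hb, hc, habc, h⟩ := mem_frontier_cone_iff.1 hp
  rcases classify_point (Z := fun a b c => val p a b c = 0)
    (fun a b c h => by rwa [val_swap₁₂]) (fun a b c h => by rwa [val_swap₂₃])
    (fun r a b c _ h => by rw [val_scale, h, mul_zero]) ha hb hc habc h with
    h | h | h | h | h | ⟨x, y, z, hz, hzy, hyx, h⟩
  · exact Or.inl h
  · exact Or.inr (Or.inl h)
  · exact Or.inr (Or.inr (Or.inl h))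
  · exact Or.inr (Or.inr (Or.inr (Or.inl h)))
  · exact Or.inr (Or.inr (Or.inr (Or.inr h)))
  · exact Or.inl (exists_zero_of_interior_zero hp hz hzy hyx h)

/-- The substance is `exists_zero_of_mem_frontier`. The other inclusion holds because a cone form
with a nonzero zero in the orthant is on the frontier, and the frontier is closed. -/
lemma frontier_cone : frontier cone = boundaryPart Cb ∪ boundaryPart C0 ∪ boundaryPart P1 ∪
    boundaryPart P2 ∪ boundaryPart P3 := by
  rw [boundaryPart_Cb, boundaryPart_C0, boundaryPart_P1, boundaryPart_P2, boundaryPart_P3]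
  apply Set.Subset.antisymm
  · intro p hp
    have hpc := (mem_frontier_cone_iff.1 hp).1
    rcases exists_zero_of_mem_frontier hp with h | h | h | h | h
    · exact Or.inl (Or.inl (Or.inl (Or.inl (subset_closure ⟨hpc, h⟩))))
    · exact Or.inl (Or.inl (Or.inl (Or.inr (subset_closure ⟨hpc, h⟩))))
    · exact Or.inl (Or.inl (Or.inr ⟨hpc, h⟩))
    · exact Or.inl (Or.inr ⟨hpc, h⟩)
    · exact Or.inr ⟨hpc, h⟩
  · refine Set.union_subset (Set.union_subset (Set.union_subset (Set.union_subset ?_ ?_) ?_) ?_) ?_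
    · refine closure_minimal ?_ isClosed_frontier
      rintro p ⟨hp, t, h1, -, h⟩
      exact mem_frontier_cone_iff.2 ⟨hp, t, 1, 1, h1.le, zero_le_one, zero_le_one, by linarith, h⟩
    · refine closure_minimal ?_ isClosed_frontier
      rintro p ⟨hp, t, h1, -, h⟩
      exact mem_frontier_cone_iff.2 ⟨hp, 0, t, 1, le_rfl, h1.le, zero_le_one, by linarith, h⟩
    · rintro p ⟨hp, h⟩
      exact mem_frontier_cone_iff.2 ⟨hp, 0, 0, 1, by norm_num, by norm_num, by norm_num,
        by norm_num, h⟩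
    · rintro p ⟨hp, h⟩
      exact mem_frontier_cone_iff.2 ⟨hp, 0, 1, 1, by norm_num, by norm_num, by norm_num,
        by norm_num, h⟩
    · rintro p ⟨hp, h⟩
      exact mem_frontier_cone_iff.2 ⟨hp, 1, 1, 1, by norm_num, by norm_num, by norm_num,
        by norm_num, h⟩

/-! ### The stratum Int(X) has too small a boundary part -/

lemma Phi_swap₁₂ (a b c : ℝ) : Phi ![b, a, c] = Phi ![a, b, c] := by
  ext i
  fin_cases i <;> simp [Phi, s, S, T, U] <;> ring

lemma Phi_swap₂₃ (a b c : ℝ) : Phi ![a, c, b] = Phi ![a, b, c] := by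
  ext i
  fin_cases i <;> simp [Phi, s, S, T, U] <;> ring

lemma Phi_scale (r a b c : ℝ) : Phi ![r * a, r * b, r * c] = r ^ 5 • Phi ![a, b, c] := by
  ext i
  fin_cases i <;> simp [Phi, s, S, T, U] <;> ring

/-- Any representative with a tie or a zero coordinate would put the point on another stratum, so
`interior_zero` applies; its two linear equations survive the closure. -/
lemma boundaryPart_intX_subset : boundaryPart intX ⊆
    {p | 5 * p 0 - p 1 - 2 * p 2 + p 3 = 0 ∧ -6 * p 0 + 3 * p 1 - 3 * p 2 - 3 * p 3 + p 4 = 0} := by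
  refine closure_minimal ?_ ?_
  · rintro p ⟨hp, x, ⟨⟨a, ha, ha0, hxa⟩, hx⟩, hpx⟩
    have hsum : 0 < a 0 + a 1 + a 2 := by
      by_contra hn
      apply ha0
      ext i
      fin_cases i <;> simp <;> linarith [ha 0, ha 1, ha 2]
    have ha' : a = ![a 0, a 1, a 2] := by
      ext i
      fin_cases i <;> rfl
    rw [ha'] at hxa
    rcases classify_point (Z := fun a b c => IsPhi x ![a, b, c])
      (fun a b c h => by rwa [IsPhi, Phi_swap₁₂]) (fun a b c h => by rwa [IsPhi, Phi_swap₂₃])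
      (fun r a b c hr h => by
        rw [IsPhi, Phi_scale, h]
        exact (Submodule.span_singleton_smul_eq
          (isUnit_iff_ne_zero.2 (pow_pos hr 5).ne') _).symm)
      (ha 0) (ha 1) (ha 2) hsum hxa with h | h | h | h | h | ⟨u, v, w, hw, hwv, hvu, h⟩
    · exact absurd (Or.inl (Or.inl (Or.inl (Or.inl h)))) hx
    · exact absurd (Or.inl (Or.inl (Or.inl (Or.inr h)))) hx
    · exact absurd (Or.inl (Or.inl (Or.inr h))) hx
    · exact absurd (Or.inl (Or.inr h)) hx
    · exact absurd (Or.inr h) hx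
    · have := (forall_mem_submodule_iff h p).1 hpx
      have := interior_zero hp hw hwv hvu this
      exact ⟨this.1, this.2.1⟩
  · exact (isClosed_eq (by fun_prop) continuous_const).inter
      (isClosed_eq (by fun_prop) continuous_const)

/-- The two linear equations express p₃ and p₄ through p₀, p₁, p₂, so the coordinate ring is a
quotient of a polynomial ring in three variables. -/
lemma sdim_boundaryPart_intX_le : sdim (boundaryPart intX) ≤ 3 := by
  let I := vanishingIdeal ℝ (boundaryPart intX)
  let φ : MvPolynomial (Fin 3) ℝ →ₐ[ℝ] MvPolynomial (Fin 5) ℝ ⧸ I :=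
    aeval fun i => Ideal.Quotient.mk I (X (Fin.castLE (by norm_num) i))
  have h3 : Ideal.Quotient.mk I (X 3) =
      Ideal.Quotient.mk I (C (-5) * X 0 + X 1 + C 2 * X 2) := by
    rw [Ideal.Quotient.eq]
    intro p hp
    have := (boundaryPart_intX_subset hp).1
    simp
    linarith
  have h4 : Ideal.Quotient.mk I (X 4) =
      Ideal.Quotient.mk I (C (-9) * X 0 + C 9 * X 2) := by
    rw [Ideal.Quotient.eq]
    intro p hp
    have := (boundaryPart_intX_subset hp)
    simp
    linarith [this.1, this.2]
  have hφ : Function.Surjective φ := by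
    have hr : ∀ i, Ideal.Quotient.mk I (X i) ∈ φ.range := by
      have e0 : Ideal.Quotient.mk I (X 0) ∈ φ.range := ⟨X 0, by simp [φ]⟩
      have e1 : Ideal.Quotient.mk I (X 1) ∈ φ.range := ⟨X 1, by simp [φ]⟩
      have e2 : Ideal.Quotient.mk I (X 2) ∈ φ.range := ⟨X 2, by simp [φ]⟩
      have eC : ∀ c : ℝ, Ideal.Quotient.mk I (C c) ∈ φ.range := fun c => φ.range.algebraMap_mem c
      intro i
      fin_cases i
      · exact e0
      · exact e1
      · exact e2
      · change Ideal.Quotient.mk I (X 3) ∈ φ.range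
        rw [h3, map_add, map_add, map_mul, map_mul]
        exact add_mem (add_mem (mul_mem (eC _) e0) e1) (mul_mem (eC _) e2)
      · change Ideal.Quotient.mk I (X 4) ∈ φ.range
        rw [h4, map_add, map_mul, map_mul]
        exact add_mem (mul_mem (eC _) e0) (mul_mem (eC _) e2)
    intro y
    obtain ⟨f, rfl⟩ := Ideal.Quotient.mk_surjective y
    change _ ∈ φ.range
    induction f using MvPolynomial.induction_on with
    | C c => exact φ.range.algebraMap_mem c
    | add f g hf hg => rw [map_add]; exact add_mem hf hg
    | mul_X f i hf => rw [map_mul]; exact mul_mem hf (hr i)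
  have := ringKrullDim_le_of_surjective φ.toRingHom hφ
  rw [ringKrullDim_mvPolynomial] at this
  exact this

lemma sdim_boundaryPart_intX_ne : sdim (boundaryPart intX) + 1 ≠ sdim cone := by
  rw [sdim_cone]
  intro h
  have h1 : (5 : WithBot ℕ∞) ≤ 3 + 1 := by
    rw [← h]
    gcongr
    exact sdim_boundaryPart_intX_le
  norm_num at h1

/-! ### The discriminants of P₁, P₂, P₃ and C⁰ -/

/-- Applies `irreducible_of_line` to the kernel of the substitution `φ`, prime because the target is
a domain; points in the image of the parametrisation are zeros of it. -/
lemma irreducible_of_param {n N : ℕ} {τ : Type*} {g : MvPolynomial (Fin n) ℝ}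
    (hN : g.totalDegree ≤ N) (φ : Fin n → MvPolynomial τ ℝ) (hg : aeval φ g = 0)
    (u v : Fin n → ℝ) (R : Finset ℝ) (hR : N ≤ R.card)
    (hφ : ∀ r ∈ R, ∃ y : τ → ℝ, ∀ i, eval y (φ i) = u i + r * v i)
    (hne : ∃ r : ℝ, eval (u + r • v) g ≠ 0) : Irreducible g := by
  have : (RingHom.ker (aeval φ : _ →ₐ[ℝ] MvPolynomial τ ℝ)).IsPrime := RingHom.ker_isPrime _
  refine irreducible_of_line hN (RingHom.ker (aeval φ : _ →ₐ[ℝ] MvPolynomial τ ℝ)) hg u v R hR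
    (fun h hh r hr => ?_) hne
  obtain ⟨y, hy⟩ := hφ r hr
  have h1 : eval y (aeval φ h) = 0 := by
    rw [(RingHom.mem_ker).1 hh, map_zero]
  have h2 : (eval y).comp (aeval φ : _ →ₐ[ℝ] MvPolynomial τ ℝ).toRingHom = eval (u + r • v) :=
    MvPolynomial.ringHom_ext (fun c => by simp) fun i => by simp [hy]
  rw [← h2]
  exact h1

/-- Both halves of `IsDisc` follow once the vanishing ideal is known to be (g); `hg0` serves the
dimension count. -/
lemma isDisc_of_graph {D : Set (ℙ ℝ (Fin 5 → ℝ))} {g : MvPolynomial (Fin 5) ℝ}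
    (hg : Irreducible g) (hg0 : eval 0 g = 0) (hA : ∀ p ∈ boundaryPart D, eval p g = 0)
    (i : Fin 5) {W : Set (Fin 5 → ℝ)} (hW : IsOpen W) (hne : W.Nonempty)
    (hWA : ∀ p ∈ W, ∃ r, Function.update p i r ∈ boundaryPart D) : IsDisc D g := by
  have h := vanishingIdeal_eq_span_of_graph hg hA i hW hne hWA
  refine ⟨?_, ?_⟩
  · rw [sdim_cone, sdim, h]
    exact ringKrullDim_quotient_span_add_one hg.ne_zero hg0
  · rw [IsDefiningEquation, vanishingIdeal_zariskiClosure, h]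

lemma isOpen_pos_orthant : IsOpen {p : Fin 5 → ℝ | ∀ i, 0 < p i} := by
  rw [Set.ofPred_forall]
  exact isOpen_iInter_of_finite fun i => isOpen_lt continuous_const (continuous_apply i)

lemma pos_orthant_nonempty : {p : Fin 5 → ℝ | ∀ i, 0 < p i}.Nonempty :=
  ⟨1, fun _ => one_pos⟩

lemma isDisc_P1 : IsDisc P1 (X 0) := by
  refine isDisc_of_graph (X_prime).irreducible (by simp) (fun p hp => ?_) 0
    isOpen_pos_orthant pos_orthant_nonempty fun p hp => ⟨0, ?_⟩
  · rw [boundaryPart_P1] at hp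
    simpa [val] using hp.2
  · rw [boundaryPart_P1]
    refine ⟨mem_cone_of_nonneg fun i => ?_, by simp [val]⟩
    fin_cases i
    · simp
    all_goals exact (hp _).le

lemma isDisc_P3 : IsDisc P3 (X 4) := by
  refine isDisc_of_graph (X_prime).irreducible (by simp) (fun p hp => ?_) 4
    isOpen_pos_orthant pos_orthant_nonempty fun p hp => ⟨0, ?_⟩
  · rw [boundaryPart_P3] at hp
    have h := hp.2
    simp only [val] at h
    rw [eval_X]
    linarith
  · rw [boundaryPart_P3]
    refine ⟨mem_cone_of_nonneg fun i => ?_, by simp [val]; ring⟩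
    fin_cases i
    pick_goal 5
    · simp
    all_goals exact (hp _).le

lemma irreducible_disc_P2 : Irreducible (X 0 + X 1 + X 2 : MvPolynomial (Fin 5) ℝ) := by
  refine irreducible_of_param (N := 1) (τ := Fin 5) ?_ ![X 0, X 1, -X 0 - X 1, X 3, X 4] ?_
    0 ![1, 0, 0, 0, 0] {0} (by simp) ?_ ⟨1, by simp⟩
  · refine (totalDegree_add _ _).trans (max_le ((totalDegree_add _ _).trans (max_le ?_ ?_)) ?_)
    all_goals rw [totalDegree_X]
  · simp
  · intro r hr
    rw [Finset.mem_singleton] at hr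
    subst hr
    refine ⟨0, fun i => ?_⟩
    fin_cases i <;> simp

lemma isDisc_P2 : IsDisc P2 (X 0 + X 1 + X 2) := by
  refine isDisc_of_graph irreducible_disc_P2 (by simp) (fun p hp => ?_) 2
    isOpen_pos_orthant pos_orthant_nonempty fun p hp => ⟨-p 0 - p 1, ?_⟩
  · rw [boundaryPart_P2] at hp
    have h := hp.2
    simp [val] at h ⊢
    linarith
  · rw [boundaryPart_P2]
    refine ⟨?_, by simp [val]; ring⟩
    have : Function.update p 2 (-p 0 - p 1) = p 0 • ![1, 0, -1, 0, 0] + p 1 • ![0, 1, -1, 0, 0]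
        + p 3 • Pi.single 3 1 + p 4 • Pi.single 4 1 := by
      ext i
      simp only [Pi.add_apply, Pi.smul_apply, smul_eq_mul]
      fin_cases i <;> simp
      ring
    rw [this]
    exact add_mem_cone (add_mem_cone (add_mem_cone
      (smul_mem_cone (hp 0).le s0_sub_s2_mem_cone) (smul_mem_cone (hp 1).le s1_sub_s2_mem_cone))
      (smul_mem_cone (hp 3).le (single_mem_cone 3))) (smul_mem_cone (hp 4).le (single_mem_cone 4))

/-- A polynomial that is nonnegative for positive arguments has only multiple positive roots. -/
lemma derivative_eval_eq_zero {f : Polynomial ℝ} (hf : ∀ t : ℝ, 0 < t → 0 ≤ f.eval t) {t : ℝ}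
    (ht : 0 < t) (h0 : f.eval t = 0) : f.derivative.eval t = 0 := by
  have hmin : IsLocalMin (fun x => f.eval x) t := by
    filter_upwards [lt_mem_nhds ht] with x hx
    rw [h0]
    exact hf x hx
  exact hmin.hasDerivAt_eq_zero (f.hasDerivAt t)

/-- The discriminant of the stratum `C⁰`. -/
def discC0 : MvPolynomial (Fin 5) ℝ := 5 * X 0 ^ 2 + 2 * X 0 * X 1 + X 1 ^ 2 - 4 * X 0 * X 2

lemma eval_discC0 (p : Fin 5 → ℝ) :
    eval p discC0 = 5 * p 0 ^ 2 + 2 * p 0 * p 1 + p 1 ^ 2 - 4 * p 0 * p 2 := by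
  simp [discC0]

lemma totalDegree_discC0_le : discC0.totalDegree ≤ 2 := by
  have h : discC0.IsHomogeneous 2 := by
    have hc : ∀ c : ℝ, (C c : MvPolynomial (Fin 5) ℝ).IsHomogeneous 0 := isHomogeneous_C _
    have hm : ∀ (c : ℝ) (i j : Fin 5), (C c * (X i * X j)).IsHomogeneous 2 := fun c i j => by
      simpa using (hc c).mul ((isHomogeneous_X ℝ i).mul (isHomogeneous_X ℝ j))
    have : discC0 = C 5 * (X 0 * X 0) + C 2 * (X 0 * X 1) + C 1 * (X 1 * X 1)
        - C 4 * (X 0 * X 2) := by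
      refine MvPolynomial.funext fun p => ?_
      rw [eval_discC0]
      simp
      ring
    rw [this]
    exact (((hm _ _ _).add (hm _ _ _)).add (hm _ _ _)).sub (hm _ _ _)
  exact h.totalDegree_le

lemma irreducible_discC0 : Irreducible discC0 := by
  refine irreducible_of_param totalDegree_discC0_le (τ := Fin 2)
    -- With y = x + 1/x one has f(0,x,1) = (x+1)x²·Q(y), where Q = p₀y² + (p₁-p₀)y + (p₂-p₁-p₀), and
    -- `discC0` is the discriminant of Q. The parametrisation is Q = p₀(y-u)², with u = `X 1`.
    ![X 0, X 0 * (1 - 2 * X 1), X 0 * (X 1 ^ 2 + 2 - 2 * X 1), 0, 0] ?_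
    ![1, 1, 2, 0, 0] ![0, -2, -1, 0, 0] {0, 1} (by simp) ?_
    ⟨1 / 2, by rw [eval_discC0]; simp; norm_num⟩
  · simp only [discC0, map_add, map_sub, map_mul, map_pow, map_ofNat, aeval_X]
    simp only [Matrix.cons_val]
    ring
  · intro r hr
    have : r = 0 ∨ r = 1 := by simpa using hr
    rcases this with rfl | rfl
    · refine ⟨![1, 0], fun i => ?_⟩
      fin_cases i <;> simp
    · refine ⟨![1, 1], fun i => ?_⟩
      fin_cases i <;> simp <;> norm_num

/-- Nonnegativity makes t a double root of the palindromic quartic f(0,x,1)/(x+1). Since x + 1/x has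
nonzero derivative at t ≠ 1, the quadratic Q in x + 1/x has a double root; `hD` below is t·Q′ = 0.
-/
lemma eval_discC0_eq_zero {p : Fin 5 → ℝ} (hp : p ∈ cone) {t : ℝ} (ht : 0 < t) (ht1 : t < 1)
    (h : val p 0 t 1 = 0) : eval p discC0 = 0 := by
  let f : Polynomial ℝ := Polynomial.C (p 0) * (.X ^ 4 - .X ^ 3 + .X ^ 2 - .X + 1)
    + Polynomial.C (p 1) * (.X ^ 3 - .X ^ 2 + .X) + Polynomial.C (p 2) * .X ^ 2
  have hval : ∀ x : ℝ, val p 0 x 1 = (x + 1) * f.eval x := fun x => by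
    simp [val, f]
    ring
  have hf : ∀ x : ℝ, 0 < x → 0 ≤ f.eval x := fun x hx => by
    have := mem_cone_iff.1 hp 0 x 1 le_rfl hx.le zero_le_one
    rw [hval] at this
    exact nonneg_of_mul_nonneg_right this (by linarith)
  have hft : f.eval t = 0 := by
    rw [hval] at h
    exact (mul_eq_zero.1 h).resolve_left (by linarith)
  have hdt := derivative_eval_eq_zero hf ht hft
  simp [f] at hft hdt
  have hD : 2 * p 0 * (t ^ 2 + 1) + (p 1 - p 0) * t = 0 := by
    have h1 : t ^ 2 - 1 ≠ 0 := by nlinarith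
    apply mul_left_cancel₀ h1
    linear_combination t * hdt - 2 * hft
  rw [eval_discC0]
  apply mul_left_cancel₀ (pow_pos ht 2).ne'
  linear_combination (2 * p 0 * (t ^ 2 + 1) + (p 1 - p 0) * t) * hD - 4 * p 0 * hft

lemma isDisc_C0 : IsDisc C0 discC0 := by
  refine isDisc_of_graph irreducible_discC0 (by rw [eval_discC0]; simp) (fun p hp => ?_) 2
    -- The condition p₁ < -3p₀ puts the double root of Q at y > 2, that is at some t in (0,1). The
    -- two remaining bounds make the coefficients of s₃ and s₄ in `hval` positive.
    (W := {p | 0 < p 0} ∩ {p | p 1 < -3 * p 0} ∩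
      {p | 4 * p 0 * (-5 * p 0 + p 1) + 2 * (5 * p 0 ^ 2 + 2 * p 0 * p 1 + p 1 ^ 2)
        < 4 * p 0 * p 3} ∩
      {p | -36 * p 0 ^ 2 + 9 * (5 * p 0 ^ 2 + 2 * p 0 * p 1 + p 1 ^ 2) < 4 * p 0 * p 4})
    ?_ ⟨![1, -5, 0, 1, 37], ?_⟩ ?_
  · rw [boundaryPart_C0] at hp
    refine closure_minimal (t := {p | eval p discC0 = 0}) ?_ ?_ hp
    · rintro p ⟨hp, t, ht, ht1, h⟩
      exact eval_discC0_eq_zero hp ht ht1 h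
    · simp only [eval_discC0]
      exact isClosed_eq (by fun_prop) continuous_const
  · refine (((isOpen_lt ?_ ?_).inter (isOpen_lt ?_ ?_)).inter (isOpen_lt ?_ ?_)).inter
      (isOpen_lt ?_ ?_) <;> fun_prop
  · refine ⟨⟨⟨?_, ?_⟩, ?_⟩, ?_⟩ <;> simp <;> norm_num
  · rintro p ⟨⟨⟨h0, h1⟩, h3⟩, h4⟩
    simp only [Set.mem_ofPred_eq] at h0 h1 h3 h4
    refine ⟨(5 * p 0 ^ 2 + 2 * p 0 * p 1 + p 1 ^ 2) / (4 * p 0), ?_⟩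
    -- With p₂ solved from `discC0 = 0`, 4p₀f is σ₁ times a square plus multiples of s₃ and s₄. The
    -- latter two vanish on a = 0, so the zero there is that of the square.
    have hval : ∀ a b c : ℝ, val (Function.update p 2
        ((5 * p 0 ^ 2 + 2 * p 0 * p 1 + p 1 ^ 2) / (4 * p 0))) a b c =
        ((a + b + c) * (2 * p 0 * (a + b + c) ^ 2
          - (5 * p 0 - p 1) * (a * b + b * c + c * a)) ^ 2
        + (4 * p 0 * p 3 - (4 * p 0 * (-5 * p 0 + p 1)
          + 2 * (5 * p 0 ^ 2 + 2 * p 0 * p 1 + p 1 ^ 2))) * val (Pi.single 3 1) a b c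
        + (4 * p 0 * p 4 - (-36 * p 0 ^ 2
          + 9 * (5 * p 0 ^ 2 + 2 * p 0 * p 1 + p 1 ^ 2))) * val (Pi.single 4 1) a b c)
          / (4 * p 0) := fun a b c => by
      simp [val]
      field_simp
      ring
    rw [boundaryPart_C0]
    refine subset_closure ⟨mem_cone_iff.2 fun a b c ha hb hc => ?_, ?_⟩
    · rw [hval]
      have e3 := mem_cone_iff.1 (single_mem_cone 3) a b c ha hb hc
      have e4 := mem_cone_iff.1 (single_mem_cone 4) a b c ha hb hc
      refine div_nonneg (add_nonneg (add_nonneg (by positivity) (mul_nonneg ?_ e3))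
        (mul_nonneg ?_ e4)) (by positivity) <;> linarith
    · obtain ⟨t, ht, hroot⟩ : ∃ t ∈ Set.Ioo (0 : ℝ) 1,
          2 * p 0 * (t ^ 2 + 1) - (p 0 - p 1) * t = 0 := by
        refine exists_root_Ioo (by fun_prop) one_pos (Or.inr ⟨?_, ?_⟩) <;> linarith
      refine ⟨t, ht.1, ht.2, ?_⟩
      rw [hval]
      have h5 : 2 * p 0 * (0 + t + 1) ^ 2 - (5 * p 0 - p 1) * (0 * t + t * 1 + 1 * 0) = 0 := by
        linear_combination hroot
      rw [h5]
      simp [val]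

/-! ### The discriminant of the quintic `f(x, 1, 1)` -/

lemma totalDegree_det_le {n ι σ : Type*} [Fintype n] [DecidableEq n] [CommRing σ]
    (M : Matrix n n (MvPolynomial ι σ)) (e : n → ℕ) (h : ∀ i j, (M i j).totalDegree ≤ e i) :
    M.det.totalDegree ≤ ∑ i, e i := by
  rw [← Matrix.det_transpose, Matrix.det_apply]
  refine totalDegree_finsetSum_le fun τ _ => ?_
  refine (totalDegree_smul_le _ _).trans ?_
  refine (totalDegree_finsetProd _ _).trans ?_
  exact Finset.sum_le_sum fun i _ => h i _

lemma quintic_eq : quintic = Polynomial.C (X 0) * Polynomial.X ^ 5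
    + Polynomial.C (2 * X 1) * Polynomial.X ^ 4
    + Polynomial.C (2 * X 2 + X 3) * Polynomial.X ^ 3
    + Polynomial.C (-2 * (X 0 + 2 * X 1 + X 2 + X 3 - X 4)) * Polynomial.X ^ 2
    + Polynomial.C (-X 0 - 2 * X 2 + X 3 + X 4) * Polynomial.X ^ 1
    + Polynomial.C (2 * (X 0 + X 1 + X 2)) * Polynomial.X ^ 0 := by
  simp [quintic]

lemma coeff_quintic_mem (k : ℕ) : quintic.coeff k ∈ restrictTotalDegree (Fin 5) ℝ 1 := by
  have hX : ∀ i, (X i : MvPolynomial (Fin 5) ℝ) ∈ restrictTotalDegree (Fin 5) ℝ 1 := fun i => by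
    rw [mem_restrictTotalDegree, totalDegree_X]
  have h2 : ∀ f : MvPolynomial (Fin 5) ℝ, f ∈ restrictTotalDegree (Fin 5) ℝ 1 →
      2 * f ∈ restrictTotalDegree (Fin 5) ℝ 1 := fun f hf => by
    rw [two_mul]
    exact add_mem hf hf
  have hite : ∀ (P : Prop) [Decidable P] (f : MvPolynomial (Fin 5) ℝ),
      f ∈ restrictTotalDegree (Fin 5) ℝ 1 → (if P then f else 0) ∈ restrictTotalDegree (Fin 5) ℝ 1 :=
    fun P _ f hf => by
      split_ifs
      · exact hf
      · exact zero_mem _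
  rw [quintic_eq]
  simp only [Polynomial.coeff_add, Polynomial.coeff_C_mul_X_pow]
  refine add_mem (add_mem (add_mem (add_mem (add_mem ?_ ?_) ?_) ?_) ?_) ?_ <;> apply hite
  · exact hX 0
  · exact h2 _ (hX 1)
  · exact add_mem (h2 _ (hX 2)) (hX 3)
  · rw [neg_mul]
    exact neg_mem (h2 _ (sub_mem (add_mem (add_mem (add_mem (hX 0) (h2 _ (hX 1))) (hX 2)) (hX 3))
      (hX 4)))
  · exact add_mem (add_mem (sub_mem (neg_mem (hX 0)) (h2 _ (hX 2))) (hX 3)) (hX 4)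
  · exact h2 _ (add_mem (add_mem (hX 0) (hX 1)) (hX 2))

lemma natDegree_quintic : quintic.natDegree = 5 := by
  unfold quintic
  compute_degree!

/-- The discriminant is, up to sign, a 9×9 determinant derived from the Sylvester matrix. The row
with index 8 has had the leading coefficient divided out and is numerical; the other eight rows are
linear in `p`. -/
lemma totalDegree_discr_quintic_le : quintic.discr.totalDegree ≤ 8 := by
  have hd : ∀ k, (Polynomial.derivative quintic).coeff k ∈ restrictTotalDegree (Fin 5) ℝ 1 :=
    fun k => by
      rw [Polynomial.coeff_derivative]
      have : quintic.coeff (k + 1) * ((k : MvPolynomial (Fin 5) ℝ) + 1)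
          = (k + 1) • quintic.coeff (k + 1) := by
        rw [nsmul_eq_mul]
        push_cast
        ring
      rw [this]
      exact nsmul_mem (coeff_quintic_mem _) _
  have hi : 2 * quintic.natDegree - 2 < quintic.natDegree - 1 + quintic.natDegree := by
    rw [natDegree_quintic]
    norm_num
  let i₀ : Fin (quintic.natDegree - 1 + quintic.natDegree) := ⟨2 * quintic.natDegree - 2, hi⟩
  have hdet : quintic.sylvesterDeriv.det.totalDegree ≤ ∑ i, if i = i₀ then 0 else 1 := by
    refine totalDegree_det_le _ _ fun i j => ?_
    rw [Polynomial.sylvesterDeriv, dif_neg (by rw [natDegree_quintic]; norm_num)]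
    by_cases h : i = i₀
    · rw [if_pos h, h, Matrix.updateRow_self]
      split_ifs
      · simp
      · rw [← map_natCast (C : ℝ →+* MvPolynomial (Fin 5) ℝ), totalDegree_C]
      · simp
    · rw [if_neg h, Matrix.updateRow_ne h, ← mem_restrictTotalDegree]
      rw [Polynomial.sylvester, Matrix.of_apply]
      refine Fin.addCases (fun j => ?_) (fun j => ?_) j
      · rw [Fin.addCases_left]
        split_ifs
        · exact coeff_quintic_mem _
        · exact zero_mem _
      · rw [Fin.addCases_right]
        split_ifs
        · exact hd _
        · exact zero_mem _
  have hsum : (∑ i : Fin (quintic.natDegree - 1 + quintic.natDegree), if i = i₀ then 0 else 1)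
      = 8 := by
    rw [Finset.sum_ite, Finset.sum_const_zero, zero_add, Finset.sum_const, smul_eq_mul, mul_one,
      Finset.filter_ne', Finset.card_erase_of_mem (Finset.mem_univ _), Finset.card_univ,
      Fintype.card_fin, natDegree_quintic]
  rw [hsum] at hdet
  rw [Polynomial.discr]
  refine (totalDegree_mul _ _).trans ?_
  have : ((-1 : MvPolynomial (Fin 5) ℝ) ^ (quintic.natDegree * (quintic.natDegree - 1) / 2))
      = 1 := by
    rw [natDegree_quintic]
    norm_num
  rw [this, totalDegree_one]
  exact hdet

/-- The polynomial `f(x, 1, 1)` for the form with coordinates `p`. -/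
def quinticAt (p : Fin 5 → ℝ) : Polynomial ℝ :=
  Polynomial.C (p 0) * Polynomial.X ^ 5
    + Polynomial.C (2 * p 1) * Polynomial.X ^ 4
    + Polynomial.C (2 * p 2 + p 3) * Polynomial.X ^ 3
    + Polynomial.C (-2 * (p 0 + 2 * p 1 + p 2 + p 3 - p 4)) * Polynomial.X ^ 2
    + Polynomial.C (-p 0 - 2 * p 2 + p 3 + p 4) * Polynomial.X
    + Polynomial.C (2 * (p 0 + p 1 + p 2))

lemma quintic_map (p : Fin 5 → ℝ) : quintic.map (eval p) = quinticAt p := by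
  simp [quintic, quinticAt]

lemma eval_quinticAt (p : Fin 5 → ℝ) (t : ℝ) : (quinticAt p).eval t = val p t 1 1 := by
  simp [quinticAt, val]
  ring

lemma eval_derivative_quinticAt (p : Fin 5 → ℝ) (t : ℝ) :
    (quinticAt p).derivative.eval t = 5 * p 0 * t ^ 4 + 8 * p 1 * t ^ 3
      + 3 * (2 * p 2 + p 3) * t ^ 2 - 4 * (p 0 + 2 * p 1 + p 2 + p 3 - p 4) * t
      + (-p 0 - 2 * p 2 + p 3 + p 4) := by
  simp [quinticAt]
  ring

lemma natDegree_quinticAt {p : Fin 5 → ℝ} (h : p 0 ≠ 0) : (quinticAt p).natDegree = 5 := by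
  unfold quinticAt
  compute_degree!

/-- The relation Res(f, f′) = lc(f)·disc(f), here with sign (-1)¹⁰, specialised at `p`. The formal
degrees 5 and 4 are kept explicit since p₀ may vanish. -/
lemma eval_discr_quintic (p : Fin 5 → ℝ) :
    p 0 * eval p quintic.discr = (quinticAt p).resultant (quinticAt p).derivative 5 4 := by
  have hpos : 0 < quintic.degree := by
    rw [← Polynomial.natDegree_pos_iff_degree_pos, natDegree_quintic]
    norm_num
  have h := Polynomial.resultant_deriv hpos
  have hlc : quintic.leadingCoeff = X 0 := by
    rw [Polynomial.leadingCoeff, natDegree_quintic, quintic_eq]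
    simp only [Polynomial.coeff_add, Polynomial.coeff_C_mul_X_pow]
    simp
  rw [natDegree_quintic, hlc] at h
  have h2 := congrArg (eval p) h
  rw [← Polynomial.resultant_map_map, ← Polynomial.derivative_map, quintic_map] at h2
  rw [h2]
  norm_num

lemma eval_discr_eq_zero {p : Fin 5 → ℝ} (hp : p 0 ≠ 0) {t : ℝ} (h : (quinticAt p).eval t = 0)
    (h' : (quinticAt p).derivative.eval t = 0) : eval p quintic.discr = 0 := by
  have h1 := eval_discr_quintic p
  have hres : (quinticAt p).resultant (quinticAt p).derivative = 0 := by
    rw [Polynomial.resultant_eq_zero_iff]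
    refine ⟨Or.inl fun h0 => ?_, fun ⟨a, b, hab⟩ => ?_⟩
    · have := natDegree_quinticAt hp
      rw [h0] at this
      simp at this
    · have := congrArg (Polynomial.eval t) hab
      simp [h, h'] at this
  rw [Polynomial.natDegree_derivative, natDegree_quinticAt hp] at hres
  rw [hres] at h1
  exact (mul_eq_zero.1 h1).resolve_left hp

lemma eval_discr_ne_zero {p : Fin 5 → ℝ} (hp : p 0 ≠ 0)
    (h : IsCoprime (quinticAt p) (quinticAt p).derivative) : eval p quintic.discr ≠ 0 := by
  intro h0
  have h1 := eval_discr_quintic p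
  rw [h0, mul_zero] at h1
  refine Polynomial.resultant_ne_zero _ _ h ?_
  rw [Polynomial.natDegree_derivative, natDegree_quinticAt hp]
  exact h1.symm

/-- The forms s₀, …, s₃ restricted to (x,1,1) vanish to second order at x = 1, so for p₄ = 0 the
quintic has a double root there. The factor `X 0` disposes of the points where the degree drops. -/
lemma X_four_dvd_discr : X 4 ∣ quintic.discr := by
  have hspan : vanishingIdeal ℝ {p : Fin 5 → ℝ | p 4 = 0} = Ideal.span {X 4} :=
    vanishingIdeal_eq_span_of_graph X_prime.irreducible (fun p hp => by simpa using hp) 4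
      isOpen_univ ⟨0, trivial⟩ fun p _ => ⟨0, by simp⟩
  have hmem : X 0 * quintic.discr ∈ vanishingIdeal ℝ {p : Fin 5 → ℝ | p 4 = 0} := by
    intro p (hp : p 4 = 0)
    rw [aeval_eq_eval, map_mul, eval_X]
    by_cases h0 : p 0 = 0
    · rw [h0, zero_mul]
    · rw [eval_discr_eq_zero h0 (t := 1), mul_zero]
      · rw [eval_quinticAt]
        simp only [val, hp]
        ring
      · rw [eval_derivative_quinticAt, hp]
        ring
  rw [hspan, Ideal.mem_span_singleton] at hmem
  refine (X_prime.dvd_or_dvd hmem).resolve_left fun hdvd => ?_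
  obtain ⟨q, hq⟩ := hdvd
  have := congrArg (eval ![1, 0, 0, 0, 0]) hq
  simp at this

lemma exists_discCb : ∃ d : MvPolynomial (Fin 5) ℝ, 16 * X 4 * d = quintic.discr := by
  obtain ⟨e, he⟩ := X_four_dvd_discr
  refine ⟨C (1 / 16) * e, ?_⟩
  have : (16 : MvPolynomial (Fin 5) ℝ) * C (1 / 16) = 1 := by
    rw [← map_ofNat C, ← map_mul]
    norm_num
  rw [he]
  linear_combination (X 4 * e) * this

/-- The discriminant of the stratum `Cᵇ`. -/
def discCb : MvPolynomial (Fin 5) ℝ := exists_discCb.choose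

lemma discCb_spec : 16 * X 4 * discCb = quintic.discr := exists_discCb.choose_spec

lemma eval_discCb_spec (p : Fin 5 → ℝ) :
    16 * p 4 * eval p discCb = eval p quintic.discr := by
  rw [← discCb_spec]
  simp

/-- The forms `f` such that `f(x, 1, 1)` has a double root `X 0`. -/
def doubleRootParam : Fin 5 → MvPolynomial (Fin 4) ℝ :=
  -- Here f(x,1,1) = (x-1)²G(x) + p₄x(2x+1) with G = ∑ gₖxᵏ. For p₄ = (t-1)³m and t ≠ 1, a double
  -- root at t means G(t) = -m(t-1)t(2t+1) and G′(t) = m(5t+1); these are solved for g₀ and g₁, with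
  -- `X 3` = g₂ + 2t·g₃ as a free parameter.
  let t := X 0
  let m := X 1
  let g₃ := X 2
  let g₂ := X 3 - 2 * X 0 * X 2
  let g₁ := m * (5 * t + 1) + X 2 * t ^ 2 - 2 * t * X 3
  let g₀ := -m * (t - 1) * t * (2 * t + 1) - m * t * (5 * t + 1) + X 3 * t ^ 2
  ![g₃, C (1 / 2) * g₂ - g₃, C (1 / 2) * (g₀ - g₂), g₁ + g₃ - g₂ - g₀, (t - 1) ^ 3 * m]

lemma eval_doubleRootParam (y : Fin 4 → ℝ) : (fun i => eval y (doubleRootParam i)) =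
    ![y 2, 1 / 2 * (y 3 - 2 * y 0 * y 2) - y 2,
      1 / 2 * ((-y 1 * (y 0 - 1) * y 0 * (2 * y 0 + 1) - y 1 * y 0 * (5 * y 0 + 1)
        + y 3 * y 0 ^ 2) - (y 3 - 2 * y 0 * y 2)),
      (y 1 * (5 * y 0 + 1) + y 2 * y 0 ^ 2 - 2 * y 0 * y 3) + y 2 - (y 3 - 2 * y 0 * y 2)
        - (-y 1 * (y 0 - 1) * y 0 * (2 * y 0 + 1) - y 1 * y 0 * (5 * y 0 + 1) + y 3 * y 0 ^ 2),
      (y 0 - 1) ^ 3 * y 1] := by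
  ext i
  fin_cases i <;> simp [doubleRootParam]

/-- The quintic discriminant vanishes at every parameter point with p₀ ≠ 0. After substitution p₀
and p₄ are nonzero polynomials, so they cancel in the domain, leaving the quotient zero even where t
= 1. -/
lemma aeval_doubleRootParam_discCb : aeval doubleRootParam discCb = 0 := by
  have hcomp : ∀ (y : Fin 4 → ℝ) (h : MvPolynomial (Fin 5) ℝ),
      eval y (aeval doubleRootParam h) = eval (fun i => eval y (doubleRootParam i)) h := fun y h => by
    have h2 : (eval y).comp (aeval doubleRootParam : _ →ₐ[ℝ] MvPolynomial (Fin 4) ℝ).toRingHom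
        = eval (fun i => eval y (doubleRootParam i)) :=
      MvPolynomial.ringHom_ext (fun c => by simp) fun i => by simp
    rw [← h2]
    rfl
  have h : aeval doubleRootParam (X 0 * (16 * X 4 * discCb)) = 0 := by
    refine MvPolynomial.funext fun y => ?_
    rw [hcomp, map_mul, discCb_spec, eval_X, map_zero]
    by_cases h0 : eval y (doubleRootParam 0) = 0
    · rw [h0, zero_mul]
    · rw [eval_discr_eq_zero h0 (t := y 0), mul_zero]
      · rw [eval_quinticAt, eval_doubleRootParam]
        simp [val]
        ring
      · rw [eval_doubleRootParam, eval_derivative_quinticAt]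
        simp
        ring
  have hX : aeval doubleRootParam (X 0 * (16 * X 4) : MvPolynomial (Fin 5) ℝ) ≠ 0 := by
    intro h0
    have := congrArg (eval ![2, 1, 1, 0]) h0
    rw [hcomp, eval_doubleRootParam] at this
    simp at this
    norm_num at this
  rw [← mul_assoc, map_mul] at h
  exact (mul_eq_zero.1 h).resolve_left hX

/-- For t ≠ 1 one may divide by powers of t - 1, so the parametrisation reaches every form with a
double root at t. -/
lemma exists_doubleRootParam {p : Fin 5 → ℝ} {t : ℝ} (ht : t ≠ 1) (h : val p t 1 1 = 0)
    (h' : (quinticAt p).derivative.eval t = 0) :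
    ∃ y : Fin 4 → ℝ, (fun i => eval y (doubleRootParam i)) = p := by
  have ht' : t - 1 ≠ 0 := sub_ne_zero.2 ht
  obtain ⟨m, hm⟩ : ∃ m, p 4 = (t - 1) ^ 3 * m := ⟨p 4 / (t - 1) ^ 3, by field_simp⟩
  rw [eval_derivative_quinticAt, hm] at h'
  simp only [val, hm] at h
  have e1 : p 0 * (t ^ 3 + 2 * t ^ 2 + 3 * t + 2) + 2 * p 1 * (t + 1) ^ 2 + 2 * p 2 * (t + 1)
      + p 3 * t + m * (t - 1) * t * (2 * t + 1) = 0 := by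
    apply mul_left_cancel₀ (pow_ne_zero 2 ht')
    linear_combination h
  have e2 : p 0 * (3 * t ^ 2 + 4 * t + 3) + 4 * p 1 * (t + 1) + 2 * p 2 + p 3
      - m * (5 * t + 1) = 0 := by
    apply mul_left_cancel₀ (pow_ne_zero 2 ht')
    linear_combination h' - 2 * (t - 1) * e1
  refine ⟨![t, m, p 0, 2 * p 0 + 2 * p 1 + 2 * t * p 0], ?_⟩
  rw [eval_doubleRootParam]
  ext i
  fin_cases i <;> simp
  · ring
  · linear_combination -(1 / 2) * e1 + (1 / 2) * t * e2
  · linear_combination e1 - (1 + t) * e2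
  · exact hm.symm

lemma eval_discCb_eq_zero {p : Fin 5 → ℝ} {t : ℝ} (ht : t ≠ 1) (h : val p t 1 1 = 0)
    (h' : (quinticAt p).derivative.eval t = 0) : eval p discCb = 0 := by
  obtain ⟨y, rfl⟩ := exists_doubleRootParam ht h h'
  have := congrArg (eval y) aeval_doubleRootParam_discCb
  have h2 : (eval y).comp (aeval doubleRootParam : _ →ₐ[ℝ] MvPolynomial (Fin 4) ℝ).toRingHom
      = eval (fun i => eval y (doubleRootParam i)) :=
    MvPolynomial.ringHom_ext (fun c => by simp) fun i => by simp
  rw [← h2]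
  simpa using this

lemma discCb_eval_ne_zero :
    eval (![-11, 61 / 2, -31 / 2, -94, 0] + (1 / 14 : ℝ) • ![1174, -1537, 1183, -5041, 81]) discCb
      ≠ 0 := by
  intro h0
  have h1 := eval_discCb_spec
    (![-11, 61 / 2, -31 / 2, -94, 0] + (1 / 14 : ℝ) • ![1174, -1537, 1183, -5041, 81])
  rw [h0, mul_zero] at h1
  refine eval_discr_ne_zero ?_ ?_ h1.symm
  · simp; norm_num
  -- Explicit Bézout cofactors for the quintic and its derivative.
  · refine ⟨Polynomial.C (14 / 10511006957352) * (-61764053200 * Polynomial.X ^ 3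
        + 58197136710 * Polynomial.X ^ 2 + 200631653385 * Polynomial.X - 163517915981),
      Polynomial.C (14 / 10511006957352) * (12352810640 * Polynomial.X ^ 4
        - 17016533150 * Polynomial.X ^ 3 - 65858006175 * Polynomial.X ^ 2
        + 108530787823 * Polynomial.X - 32184048088), ?_⟩
    refine Polynomial.funext fun x => ?_
    simp only [Polynomial.eval_add, Polynomial.eval_mul, eval_quinticAt, eval_derivative_quinticAt]
    simp [val]
    ring

lemma totalDegree_discCb_le : discCb.totalDegree ≤ 7 := by
  have h := totalDegree_discr_quintic_le
  have hne : discCb ≠ 0 := fun h0 => discCb_eval_ne_zero (by rw [h0, map_zero])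
  have h16 : (16 * X 4 : MvPolynomial (Fin 5) ℝ) = C 16 * X 4 := by rw [map_ofNat]
  rw [← discCb_spec, h16, totalDegree_mul_of_isDomain (mul_ne_zero (by simp) (X_ne_zero 4)) hne,
    totalDegree_mul_of_isDomain (by simp) (X_ne_zero 4), totalDegree_C, totalDegree_X] at h
  omega

lemma irreducible_discCb : Irreducible discCb := by
  refine irreducible_of_param totalDegree_discCb_le doubleRootParam aeval_doubleRootParam_discCb
    -- A line with seven rational points in the image of the parametrisation, matching the degree
    -- bound 7. The six with r ≠ 0 have the double roots 5/2, 1/4, 2, 2/5, 8/5, 4/7.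
    ![-11, 61 / 2, -31 / 2, -94, 0] ![1174, -1537, 1183, -5041, 81]
    {0, 1 / 270, -1 / 270, 1 / 416, -1 / 416, 1 / 459, -1 / 459} ?_ ?_ ⟨_, discCb_eval_ne_zero⟩
  · rw [Finset.card_insert_of_notMem, Finset.card_insert_of_notMem, Finset.card_insert_of_notMem,
      Finset.card_insert_of_notMem, Finset.card_insert_of_notMem, Finset.card_insert_of_notMem,
      Finset.card_singleton]
    all_goals
      simp only [Finset.mem_insert, Finset.mem_singleton]
      norm_num
  · have key : ∀ r t : ℝ, t ≠ 1 →
        val (fun i => ![-11, 61 / 2, -31 / 2, -94, 0] i + r * ![1174, -1537, 1183, -5041, 81] i)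
          t 1 1 = 0 →
        (quinticAt (fun i => ![-11, 61 / 2, -31 / 2, -94, 0] i
          + r * ![1174, -1537, 1183, -5041, 81] i)).derivative.eval t = 0 →
        ∃ y : Fin 4 → ℝ, ∀ i, eval y (doubleRootParam i)
          = ![-11, 61 / 2, -31 / 2, -94, 0] i + r * ![1174, -1537, 1183, -5041, 81] i := by
      intro r t ht h h'
      obtain ⟨y, hy⟩ := exists_doubleRootParam ht h h'
      exact ⟨y, congrFun hy⟩
    intro r hr
    simp only [Finset.mem_insert, Finset.mem_singleton] at hr
    rcases hr with rfl | rfl | rfl | rfl | rfl | rfl | rfl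
    -- At r = 0 one has p₄ = 0 and a triple root at x = 1, out of reach of `exists_doubleRootParam`;
    -- the parameters are given directly with t = 1.
    · refine ⟨![1, 3 / 2, -11, 17], fun i => ?_⟩
      refine (congrFun (eval_doubleRootParam _) i).trans ?_
      fin_cases i <;> simp <;> norm_num
    · refine key _ (5 / 2) (by norm_num) ?_ ?_
      · simp [val]; norm_num
      · rw [eval_derivative_quinticAt]; simp; norm_num
    · refine key _ (1 / 4) (by norm_num) ?_ ?_
      · simp [val]; norm_num
      · rw [eval_derivative_quinticAt]; simp; norm_num
    · refine key _ 2 (by norm_num) ?_ ?_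
      · simp [val]; norm_num
      · rw [eval_derivative_quinticAt]; simp; norm_num
    · refine key _ (2 / 5) (by norm_num) ?_ ?_
      · simp [val]; norm_num
      · rw [eval_derivative_quinticAt]; simp; norm_num
    · refine key _ (8 / 5) (by norm_num) ?_ ?_
      · simp [val]; norm_num
      · rw [eval_derivative_quinticAt]; simp; norm_num
    · refine key _ (4 / 7) (by norm_num) ?_ ?_
      · simp [val]; norm_num
      · rw [eval_derivative_quinticAt]; simp; norm_num

/-! ### The discriminant of Cᵇ -/

/-- Lowering the coordinate `p 3` of an interior form until it leaves the cone produces a zero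
on the stratum `Cᵇ`. -/
lemma exists_update_mem_boundaryPart_Cb {p : Fin 5 → ℝ} (hp : p ∈ interior cone) :
    ∃ r, Function.update p 3 r ∈ boundaryPart Cb := by
  let q : ℝ → Fin 5 → ℝ := fun r => Function.update p 3 (p 3 - r)
  have hq : Continuous q := by
    refine continuous_pi fun i => ?_
    by_cases hi : i = 3
    · subst hi
      simp only [q, Function.update_self]
      fun_prop
    · simp only [q, Function.update_of_ne hi]
      fun_prop
  have hval : ∀ r a b c, val (q r) a b c = val p a b c - r * val (Pi.single 3 1) a b c :=
    fun r a b c => by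
      simp [val, q]
      ring
  let R := {r | q r ∈ cone}
  have hbdd : BddAbove R := by
    refine ⟨val p 2 1 1 / 2, fun r hr => ?_⟩
    -- s₃(2,1,1) = 2 > 0, so p₃ cannot be lowered indefinitely.
    have h := mem_cone_iff.1 hr 2 1 1 (by norm_num) (by norm_num) (by norm_num)
    rw [hval] at h
    have h2 : val (Pi.single 3 1) 2 1 1 = 2 := by
      simp [val]
      norm_num
    rw [h2] at h
    linarith
  have h0 : q 0 = p := by simp [q]
  have hne : R.Nonempty := ⟨0, by
    change q 0 ∈ cone
    rw [h0]
    exact interior_subset hp⟩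
  have hmem : q (sSup R) ∈ cone := (isClosed_cone.preimage hq).csSup_mem hne hbdd
  have hfr : q (sSup R) ∈ frontier cone := by
    rw [frontier, isClosed_cone.closure_eq]
    refine ⟨hmem, fun hq_mem => ?_⟩
    obtain ⟨ε, hε, hb⟩ := Metric.isOpen_iff.1 (isOpen_interior.preimage hq) _ hq_mem
    have hball : sSup R + ε / 2 ∈ Metric.ball (sSup R) ε := by
      rw [Metric.mem_ball, Real.dist_eq, add_sub_cancel_left, abs_of_pos (half_pos hε)]
      linarith
    have hq_int : q (sSup R + ε / 2) ∈ interior cone := hb hball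
    have hcone : q (sSup R + ε / 2) ∈ cone := interior_subset hq_int
    have := le_csSup hbdd (show sSup R + ε / 2 ∈ R from hcone)
    linarith
  have hpos := mem_interior_cone_iff.1 hp
  refine ⟨p 3 - sSup R, ?_⟩
  rw [boundaryPart_Cb]
  refine subset_closure ⟨hmem, ?_⟩
  -- s₃ vanishes on C⁰, P₁, P₂ and P₃, so a zero there would already be a zero of the interior form
  -- `p`. Only Cᵇ remains.
  rcases exists_zero_of_mem_frontier hfr with h | ⟨t, ht, -, h⟩ | h | h | h
  · exact h
  · have h1 := hpos 0 t 1 le_rfl ht.le zero_le_one (by linarith)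
    rw [hval] at h
    simp [val] at h h1
    linarith
  · have h1 := hpos 0 0 1 le_rfl le_rfl zero_le_one (by norm_num)
    rw [hval] at h
    simp [val] at h h1
    linarith
  · have h1 := hpos 0 1 1 le_rfl zero_le_one zero_le_one (by norm_num)
    rw [hval] at h
    simp [val] at h h1
    linarith
  · have h1 := hpos 1 1 1 zero_le_one zero_le_one zero_le_one (by norm_num)
    rw [hval] at h
    simp [val] at h h1
    linarith

lemma isDisc_Cb : IsDisc Cb discCb := by
  refine isDisc_of_graph irreducible_discCb ?_ (fun p hp => ?_) 3 isOpen_interior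
    interior_cone_nonempty fun p hp => exists_update_mem_boundaryPart_Cb hp
  · refine eval_discCb_eq_zero (t := 0) zero_ne_one ?_ ?_
    · simp [val]
    · rw [eval_derivative_quinticAt]
      simp
  · rw [boundaryPart_Cb] at hp
    refine closure_minimal (t := {p | eval p discCb = 0}) ?_ ?_ hp
    · rintro p ⟨hp, t, ht, ht1, h⟩
      refine eval_discCb_eq_zero ht1 h (derivative_eval_eq_zero (fun x hx => ?_) ht ?_)
      · rw [eval_quinticAt]
        exact mem_cone_iff.1 hp x 1 1 hx.le zero_le_one zero_le_one
      · rw [eval_quinticAt, h]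
    · exact isClosed_eq discCb.continuous_eval continuous_const

/-! ### Uniqueness of discriminants and the minimal primes -/

lemma IsDisc.vanishingIdeal_eq {D : Set (ℙ ℝ (Fin 5 → ℝ))} {g : MvPolynomial (Fin 5) ℝ}
    (h : IsDisc D g) : vanishingIdeal ℝ (boundaryPart D) = Ideal.span {g} := by
  rw [← vanishingIdeal_zariskiClosure]
  exact h.2

/-- The discriminant of a stratum is unique up to a unit. -/
lemma IsDisc.associated {D : Set (ℙ ℝ (Fin 5 → ℝ))} {g h : MvPolynomial (Fin 5) ℝ}
    (hg : IsDisc D g) (hh : IsDisc D h) : Associated g h := by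
  rw [← Ideal.span_singleton_eq_span_singleton, ← hg.vanishingIdeal_eq, hh.vanishingIdeal_eq]

lemma vanishingIdeal_union (A B : Set (Fin 5 → ℝ)) :
    vanishingIdeal ℝ (A ∪ B) = vanishingIdeal ℝ A ⊓ vanishingIdeal ℝ B := by
  ext f
  simp only [Ideal.mem_inf, mem_vanishingIdeal_iff, Set.mem_union, or_imp, forall_and]

/-- The ideal of the frontier is the intersection of five principal primes. The generators need not
be compared pairwise: an inclusion between ideals generated by irreducibles forces equality. -/
lemma minimalPrimes_vanishingIdeal_frontier :
    (vanishingIdeal ℝ (frontier cone)).minimalPrimes =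
      {Ideal.span {X 0}, Ideal.span {X 0 + X 1 + X 2}, Ideal.span {X 4}, Ideal.span {discC0},
        Ideal.span {discCb}} := by
  have h : vanishingIdeal ℝ (frontier cone) = sInf {Ideal.span {X 0}, Ideal.span {X 0 + X 1 + X 2},
      Ideal.span {X 4}, Ideal.span {discC0}, Ideal.span {discCb}} := by
    rw [frontier_cone, vanishingIdeal_union, vanishingIdeal_union, vanishingIdeal_union,
      vanishingIdeal_union, isDisc_Cb.vanishingIdeal_eq, isDisc_C0.vanishingIdeal_eq,
      isDisc_P1.vanishingIdeal_eq, isDisc_P2.vanishingIdeal_eq, isDisc_P3.vanishingIdeal_eq]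
    simp only [sInf_insert, sInf_singleton]
    ac_rfl
  have hirr : ∀ I ∈ ({Ideal.span {X 0}, Ideal.span {X 0 + X 1 + X 2}, Ideal.span {X 4},
      Ideal.span {discC0}, Ideal.span {discCb}} : Set (Ideal (MvPolynomial (Fin 5) ℝ))),
      ∃ g, Irreducible g ∧ I = Ideal.span {g} := by
    rintro I (rfl | rfl | rfl | rfl | rfl)
    · exact ⟨_, X_prime.irreducible, rfl⟩
    · exact ⟨_, irreducible_disc_P2, rfl⟩
    · exact ⟨_, X_prime.irreducible, rfl⟩
    · exact ⟨_, irreducible_discC0, rfl⟩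
    · exact ⟨_, irreducible_discCb, rfl⟩
  rw [h]
  refine minimalPrimes_sInf (Set.toFinite _) (fun I hI => ?_) fun I hI J hJ hIJ => ?_
  · obtain ⟨g, hg, rfl⟩ := hirr I hI
    exact (Ideal.span_singleton_prime hg.ne_zero).2 hg.prime
  · obtain ⟨g, hg, rfl⟩ := hirr I hI
    obtain ⟨g', hg', rfl⟩ := hirr J hJ
    rw [Ideal.span_singleton_le_span_singleton] at hIJ
    exact Ideal.span_singleton_eq_span_singleton.2 ((hg'.associated_of_dvd hg hIJ).symm)

end SymQuintic

end
theorem theorem4p17 :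
    -- the `s_i` form a base of the space of symmetric quintic forms
    Set.BijOn SymQuintic.form Set.univ SymQuintic.symForms ∧
    -- `d` is the discriminant of `f(x,1,1)` divided by `16 p_4`
    ∃ d : MvPolynomial (Fin 5) ℝ,
      16 * X 4 * d = SymQuintic.quintic.discr ∧
      -- the five discriminants
      SymQuintic.IsDisc SymQuintic.P1 (X 0) ∧
      SymQuintic.IsDisc SymQuintic.P2 (X 0 + X 1 + X 2) ∧
      SymQuintic.IsDisc SymQuintic.P3 (X 4) ∧
      SymQuintic.IsDisc SymQuintic.C0
        (5 * X 0 ^ 2 + 2 * X 0 * X 1 + X 1 ^ 2 - 4 * X 0 * X 2) ∧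
      SymQuintic.IsDisc SymQuintic.Cb d ∧
      -- there are no others, up to a nonzero constant factor
      SymQuintic.sdim (SymQuintic.boundaryPart SymQuintic.intX) + 1
        ≠ SymQuintic.sdim SymQuintic.cone ∧
      (∀ g : MvPolynomial (Fin 5) ℝ,
        (∃ D ∈ SymQuintic.criticalDecomposition, SymQuintic.IsDisc D g) →
          Associated g (X 0) ∨ Associated g (X 0 + X 1 + X 2) ∨ Associated g (X 4) ∨
          Associated g (5 * X 0 ^ 2 + 2 * X 0 * X 1 + X 1 ^ 2 - 4 * X 0 * X 2) ∨
          Associated g d) ∧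
      -- the boundary of the cone is the union of the five components
      frontier SymQuintic.cone =
        SymQuintic.boundaryPart SymQuintic.Cb ∪ SymQuintic.boundaryPart SymQuintic.C0 ∪
        SymQuintic.boundaryPart SymQuintic.P1 ∪ SymQuintic.boundaryPart SymQuintic.P2 ∪
        SymQuintic.boundaryPart SymQuintic.P3 ∧
      -- the irreducible components of its Zariski closure are the five hypersurfaces
      (vanishingIdeal ℝ (frontier SymQuintic.cone)).minimalPrimes =
        {Ideal.span {X 0}, Ideal.span {X 0 + X 1 + X 2}, Ideal.span {X 4},
         Ideal.span {5 * X 0 ^ 2 + 2 * X 0 * X 1 + X 1 ^ 2 - 4 * X 0 * X 2},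
         Ideal.span {d}} := by
  refine ⟨SymQuintic.form_bijOn, SymQuintic.discCb, SymQuintic.discCb_spec, SymQuintic.isDisc_P1,
    SymQuintic.isDisc_P2, SymQuintic.isDisc_P3, SymQuintic.isDisc_C0, SymQuintic.isDisc_Cb,
    SymQuintic.sdim_boundaryPart_intX_ne, ?_, SymQuintic.frontier_cone,
    SymQuintic.minimalPrimes_vanishingIdeal_frontier⟩
  rintro g ⟨D, (rfl | rfl | rfl | rfl | rfl | rfl), hD⟩
  · exact absurd hD.1 SymQuintic.sdim_boundaryPart_intX_ne
  · exact Or.inr (Or.inr (Or.inr (Or.inr (hD.associated SymQuintic.isDisc_Cb))))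
  · exact Or.inr (Or.inr (Or.inr (Or.inl (hD.associated SymQuintic.isDisc_C0))))
  · exact Or.inl (hD.associated SymQuintic.isDisc_P1)
  · exact Or.inr (Or.inl (hD.associated SymQuintic.isDisc_P2))
  · exact Or.inr (Or.inr (Or.inl (hD.associated SymQuintic.isDisc_P3)))
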